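/- Let $R$ be a principal ideal domain. A weighted digraph $(G,w)$ consists of a nonempty finite set $V$, a set $E\subseteq\{(i,j)\in V\times V: i\ne j\}$ of directed edges and a function $w:V\to R$ with no zero value. A morphism $f:(G,w)\to(H,v)$ of weighted digraphs is a map of the vertex sets such that every edge $(i,j)$ of $G$ has $f(i)=f(j)$ or $(f(i),f(j))$ an edge of $H$, and such that $w(i)=v(f(i))$ for all $i$. *Weighted path homology.* For $p\ge -1$ let $\Lambda_p(V)$ be the free $R$-module on the sequences $e_{i_0\cdots i_p}$ of $p+1$ vertices (so $\Lambda_{-1}(V)=R$, spanned by the empty sequence), and let $\partial^w e_{i_0\cdots i_p}=\sum_{q=0}^p(-1)^q w(i_q)\,e_{i_0\cdots\widehat{i_q}\cdots i_p}$. The sequences with $i_k=i_{k+1}$ for some $k$ span a subcomplex; identify the quotient by it with the span $\mathcal R_p(V)$ of the other (regular) sequences, with the induced operator $\partial^w$. Let $\mathcal A_p(G)\subseteq\mathcal R_p(V)$ be the span of the allowed sequences, those with $(i_{k-1},i_k)\in E$ for all $1\le k\le p$, and let $\Omega^w_p(G)=\{v\in\mathcal A_p(G):\partial^w v\in\mathcal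 A_{p-1}(G)\}$, with $\Omega^w_{-1}(G)=R$. For $p\ge -1$ let $H_p(G,w;R)$ be the homology of the augmented complex $$\cdots\to\Omega^w_1(G)\to\Omega^w_0(G)\to R\to 0$$ at $\Omega^w_p(G)$, and put $H_{-2}=0$. A morphism $f$ induces $f_*$ on $H_p$, via $e_{i_0\cdots i_p}\mapsto e_{f(i_0)\cdots f(i_p)}$ (read as $0$ if the latter is not regular). *Joins.* The join $(G*G',w*w')$ of two weighted digraphs has vertex set $V\sqcup V'$, edge set $E\sqcup E'\sqcup (V\times V')$, and the weight that equals $w$ on $V$ and $w'$ on $V'$. Morphisms $f,f'$ of weighted digraphs induce the morphism $f*f'$ of the joins that equals $f$ on $V$ and $f'$ on $V'$. **Theorem (persistent Künneth formula).** Fix $r\ge 0$. For weighted digraphs $(G,w)$ and $(G',w')$ let $$\alpha_{G,G'}:\bigoplus_{p,q\ge -1,\ p+q=r-1}H_p(G,w;R)\otimes_R H_q(G',w';R)\to H_r(G*G',w*w';R)$$ be the map induced by concatenation of paths, $[u]\otimes[v]\mapsto[uv]$. There are homomorphisms $$\beta_{G,G'}:H_r(G*G',w*w';R)\to\bigoplus_{p,q\ge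 -1,\ p+q=r-1}\mathrm{Tor}_1^R\big(H_p(G,w;R),H_{q-1}(G',w';R)\big),$$ one for each pair of weighted digraphs, such that the following hold. 1. For all $(G,w)$ and $(G',w')$ the sequence $$0\to\bigoplus_{p+q=r-1}H_p(G,w;R)\otimes_R H_q(G',w';R)\xrightarrow{\ \alpha_{G,G'}\ }H_r(G*G',w*w';R)\xrightarrow{\ \beta_{G,G'}\ }\bigoplus_{p+q=r-1}\mathrm{Tor}_1^R\big(H_p(G,w;R),H_{q-1}(G',w';R)\big)\to 0$$ is exact and splits. 2. For all finite or infinite sequences of morphisms of weighted digraphs $f_n:(G_n,w_n)\to(G_{n+1},w_{n+1})$ and $f'_n:(G'_n,w'_n)\to(G'_{n+1},w'_{n+1})$, of the same length, the sequences of part 1 for the pairs $(G_n,w_n),(G'_n,w'_n)$ are the rows of a commutative ladder whose vertical maps from row $n$ to row $n+1$ are $\bigoplus (f_n)_*\otimes(f'_n)_*$, $(f_n*f'_n)_*$ and $\bigoplus\mathrm{Tor}_1^R\big((f_n)_*,(f'_n)_*\big)$. -/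

import Mathlib

open CategoryTheory TensorProduct DirectSum

universe u

noncomputable section

/-! ### Subquotients -/

/-- The quotient `Z / B` of submodules `B ≤ Z` (in general, `Z / (Z ∩ B)`). -/
def Subquotient {R M : Type u} [CommRing R] [AddCommGroup M] [Module R M]
    (Z B : Submodule R M) : Type u := Z ⧸ B.submoduleOf Z

namespace Subquotient

variable {R M N P : Type u} [CommRing R] [AddCommGroup M] [Module R M] [AddCommGroup N]
  [Module R N] [AddCommGroup P] [Module R P]

instance (Z B : Submodule R M) : AddCommGroup (Subquotient Z B) :=
  inferInstanceAs (AddCommGroup (Z ⧸ B.submoduleOf Z))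

instance (Z B : Submodule R M) : Module R (Subquotient Z B) :=
  inferInstanceAs (Module R (Z ⧸ B.submoduleOf Z))

/-- The class of an element. -/
def mk (Z B : Submodule R M) : Z →ₗ[R] Subquotient Z B := (B.submoduleOf Z).mkQ

theorem mk_surjective (Z B : Submodule R M) : Function.Surjective (mk Z B) :=
  Submodule.mkQ_surjective _

theorem mk_eq_zero (Z B : Submodule R M) (z : Z) : mk Z B z = 0 ↔ (z : M) ∈ B :=
  Submodule.Quotient.mk_eq_zero _

/-- The linear map `[z] ↦ [f z]`. -/
def map {Z B : Submodule R M} {Z' B' : Submodule R N} (f : M →ₗ[R] N)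
    (hZ : ∀ x ∈ Z, f x ∈ Z') (hB : ∀ x ∈ B, f x ∈ B') :
    Subquotient Z B →ₗ[R] Subquotient Z' B' :=
  Submodule.mapQ _ _ (f.restrict hZ) fun x hx => hB x.1 hx

theorem map_mk {Z B : Submodule R M} {Z' B' : Submodule R N} (f : M →ₗ[R] N)
    (hZ : ∀ x ∈ Z, f x ∈ Z') (hB : ∀ x ∈ B, f x ∈ B') (z : Z) :
    map f hZ hB (mk Z B z) = mk Z' B' ⟨f z.1, hZ z.1 z.2⟩ := rfl

/-- The linear map `[x] ⊗ [y] ↦ [f x y]`. -/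
def cross {Z B : Submodule R M} {Z' B' : Submodule R N} {Y C : Submodule R P}
    (f : M →ₗ[R] N →ₗ[R] P)
    (hZ : ∀ x ∈ Z, ∀ y ∈ Z', f x y ∈ Y)
    (hl : ∀ x ∈ B, ∀ y ∈ Z', f x y ∈ C) (hr : ∀ x ∈ Z, ∀ y ∈ B', f x y ∈ C) :
    Subquotient Z B ⊗[R] Subquotient Z' B' →ₗ[R] Subquotient Y C :=
  let g : Z →ₗ[R] Z' →ₗ[R] Subquotient Y C :=
    LinearMap.mk₂ R (fun x y => mk Y C ⟨f x.1 y.1, hZ x.1 x.2 y.1 y.2⟩)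
      (fun x x' y => by rw [← map_add]; congr 1; ext1; simp)
      (fun c x y => by rw [← map_smul]; congr 1; ext1; simp)
      (fun x y y' => by rw [← map_add]; congr 1; ext1; simp)
      (fun c x y => by rw [← map_smul]; congr 1; ext1; simp)
  TensorProduct.lift
    (Submodule.liftQ (B.submoduleOf Z)
      (LinearMap.flip
        (Submodule.liftQ (B'.submoduleOf Z') g.flip (by
          intro y hy
          refine LinearMap.mem_ker.2 (LinearMap.ext fun x => ?_)
          exact (mk_eq_zero Y C _).2 (hr x.1 x.2 y.1 hy))))
      (by
        intro x hx
        refine LinearMap.mem_ker.2 (LinearMap.ext fun y => ?_)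
        obtain ⟨y, rfl⟩ := Submodule.mkQ_surjective _ y
        exact (mk_eq_zero Y C _).2 (hl x.1 hx y.1 y.2)))

theorem cross_mk {Z B : Submodule R M} {Z' B' : Submodule R N} {Y C : Submodule R P}
    (f : M →ₗ[R] N →ₗ[R] P)
    (hZ : ∀ x ∈ Z, ∀ y ∈ Z', f x y ∈ Y)
    (hl : ∀ x ∈ B, ∀ y ∈ Z', f x y ∈ C) (hr : ∀ x ∈ Z, ∀ y ∈ B', f x y ∈ C)
    (x : Z) (y : Z') :
    cross f hZ hl hr (mk Z B x ⊗ₜ mk Z' B' y) = mk Y C ⟨f x.1 y.1, hZ x.1 x.2 y.1 y.2⟩ := rfl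

end Subquotient

/-! ### Paths on a set, the weighted boundary operator

An elementary `p`-path on `V` is a sequence of `p + 1` vertices, i.e. a list of length `p + 1`;
the elementary `(-1)`-path is the empty list.  Throughout, degrees are indexed by the number
`k = p + 1` of vertices, so `k = 0, 1, 2, …` stands for `p = -1, 0, 1, …`. -/

/-- `Λ_*(V)`: formal `R`-linear combinations of elementary paths on `V` (all degrees together). -/
abbrev PathModule (R V : Type u) [CommRing R] : Type u := List V →₀ R

namespace PathModule

variable {R : Type u} [CommRing R] {V V' : Type u}

/-- `∂^w (e_{i_0 ⋯ i_p}) = ∑_q (-1)^q w(i_q) e_{i_0 ⋯ î_q ⋯ i_p}`, extended linearly. -/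
def boundary (w : V → R) : PathModule R V →ₗ[R] PathModule R V :=
  Finsupp.linearCombination R fun l : List V =>
    ∑ q : Fin l.length, ((-1 : R) ^ (q : ℕ) * w (l.get q)) • Finsupp.single (l.eraseIdx q) (1 : R)

/-- A path is regular when consecutive vertices are distinct. -/
def IsRegularPath (l : List V) : Prop := l.IsChain (· ≠ ·)

open Classical in
/-- The projection `Λ_*(V) → 𝓡_*(V)` onto the span of the regular elementary paths along the span
`𝓘_*(V)` of the non-regular ones, i.e. the quotient map under `𝓡_*(V) ≅ Λ_*(V) / 𝓘_*(V)`. -/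
def regularize (R V : Type u) [CommRing R] : PathModule R V →ₗ[R] PathModule R V :=
  Finsupp.linearCombination R fun l : List V =>
    if IsRegularPath l then Finsupp.single l (1 : R) else 0

/-- The boundary operator induced by `∂^w` on regular paths. -/
def regBoundary (w : V → R) : PathModule R V →ₗ[R] PathModule R V :=
  regularize R V ∘ₗ boundary w

/-- The map `f_#` on regular paths: `e_{i_0 ⋯ i_p} ↦ e_{f(i_0) ⋯ f(i_p)}` if the latter is regular,
and `0` otherwise. -/
def push (R : Type u) [CommRing R] (f : V → V') : PathModule R V →ₗ[R] PathModule R V' :=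
  regularize R V' ∘ₗ Finsupp.lmapDomain R R (List.map f)

/-- Concatenation `e_{i_0 ⋯ i_p} ⊗ e_{j_0 ⋯ j_q} ↦ e_{i_0 ⋯ i_p j_0 ⋯ j_q}`. -/
def concat (R V V' : Type u) [CommRing R] :
    PathModule R V →ₗ[R] PathModule R V' →ₗ[R] PathModule R (V ⊕ V') :=
  Finsupp.linearCombination R fun l : List V =>
    Finsupp.lmapDomain R R fun l' : List V' => l.map Sum.inl ++ l'.map Sum.inr

/-! Auxiliary facts. -/

/-- Prepending a vertex. -/
def cons (a : V) : PathModule R V →ₗ[R] PathModule R V := Finsupp.lmapDomain R R (List.cons a)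

@[simp] theorem cons_single (a : V) (l : List V) (c : R) :
    cons a (Finsupp.single l c) = Finsupp.single (a :: l) c := by
  simp [cons, Finsupp.mapDomain_single]

theorem boundary_nil (w : V → R) (c : R) : boundary w (Finsupp.single [] c) = 0 := by
  simp [boundary]

theorem boundary_cons_single (w : V → R) (a : V) (l : List V) :
    boundary w (Finsupp.single (a :: l) 1) =
      w a • Finsupp.single l 1 - cons a (boundary w (Finsupp.single l 1)) := by
  simp only [boundary, Finsupp.linearCombination_single, one_smul]
  simp only [List.length_cons, Fin.sum_univ_succ, map_sum, map_smul]
  simp [sub_eq_add_neg, ← Finset.sum_neg_distrib, pow_succ]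

theorem boundary_cons (w : V → R) (a : V) (x : PathModule R V) :
    boundary w (cons a x) = w a • x - cons a (boundary w x) := by
  have : boundary w ∘ₗ cons a = w a • LinearMap.id - cons a ∘ₗ boundary w := by
    ext1 l
    ext1
    simpa using boundary_cons_single w a l
  simpa using LinearMap.congr_fun this x

theorem boundary_boundary (w : V → R) (x : PathModule R V) : boundary w (boundary w x) = 0 := by
  have : boundary w ∘ₗ boundary w = 0 := by
    ext1 l
    ext1
    simp only [LinearMap.comp_apply, Finsupp.lsingle_apply, LinearMap.zero_apply]
    induction l with
    | nil => simp [boundary_nil]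
    | cons a l ih => rw [boundary_cons_single, map_sub, boundary_cons, ih, map_smul]; simp
  simpa using LinearMap.congr_fun this x

theorem boundary_map (w : V → R) (w' : V' → R) (f : V → V') (h : ∀ i, w i = w' (f i))
    (x : PathModule R V) :
    boundary w' (Finsupp.lmapDomain R R (List.map f) x) =
      Finsupp.lmapDomain R R (List.map f) (boundary w x) := by
  have hc : ∀ (a : V) (y : PathModule R V), Finsupp.lmapDomain R R (List.map f) (cons a y) =
      cons (f a) (Finsupp.lmapDomain R R (List.map f) y) := by
    intro a y
    simp only [cons, Finsupp.lmapDomain_apply, ← Finsupp.mapDomain_comp]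
    rfl
  have : boundary w' ∘ₗ Finsupp.lmapDomain R R (List.map f) =
      Finsupp.lmapDomain R R (List.map f) ∘ₗ boundary w := by
    ext1 l
    ext1
    simp only [LinearMap.comp_apply, Finsupp.lsingle_apply]
    induction l with
    | nil => simp [boundary_nil, Finsupp.mapDomain_single]
    | cons a l ih =>
      rw [← cons_single, hc, boundary_cons, ih, boundary_cons, map_sub, hc, h, map_smul]
  simpa using LinearMap.congr_fun this x

open Classical in
theorem regularize_single (l : List V) :
    regularize R V (Finsupp.single l 1) = if IsRegularPath l then Finsupp.single l (1 : R) else 0 := by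
  simp [regularize]

theorem regularize_idem (x : PathModule R V) :
    regularize R V (regularize R V x) = regularize R V x := by
  have : regularize R V ∘ₗ regularize R V = regularize R V := by
    ext1 l
    ext1
    simp only [LinearMap.comp_apply, Finsupp.lsingle_apply, regularize_single]
    split_ifs with h <;> simp [regularize_single, h]
  simpa using LinearMap.congr_fun this x

theorem regularize_cons (a : V) (x : PathModule R V) :
    regularize R V (cons a (regularize R V x)) = regularize R V (cons a x) := by
  have : regularize R V ∘ₗ cons a ∘ₗ regularize R V = regularize R V ∘ₗ cons a := by
    ext1 l
    ext1
    simp only [LinearMap.comp_apply, Finsupp.lsingle_apply, regularize_single, cons_single]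
    split_ifs with h1 h2 h2
    · simp [regularize_single, h2]
    · simp [regularize_single, h2]
    · exact absurd (List.IsChain.tail h2) h1
    · simp
  simpa using LinearMap.congr_fun this x

theorem regularize_boundary_of_not (w : V → R) (l : List V) (hl : ¬ IsRegularPath l) :
    regularize R V (boundary w (Finsupp.single l 1)) = 0 := by
  induction l with
  | nil => simp [boundary_nil]
  | cons a l ih =>
    by_cases h : IsRegularPath l
    · cases l with
      | nil => exact absurd (List.isChain_singleton a) hl
      | cons b m =>
        have hab : a = b := by
          by_contra hab
          exact hl (List.isChain_cons_cons.2 ⟨hab, h⟩)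
        subst hab
        rw [boundary_cons_single, boundary_cons_single, map_sub (cons a), map_smul (cons a),
          cons_single, sub_sub_cancel]
        generalize boundary w (Finsupp.single m (1 : R)) = x
        have : regularize R V ∘ₗ cons a ∘ₗ cons a = 0 := by
          ext1 l
          ext1
          simp [regularize_single, IsRegularPath]
        simpa using LinearMap.congr_fun this x
    · rw [boundary_cons_single, map_sub, ← regularize_cons, ih h, map_smul, regularize_single, if_neg h]
      simp

theorem regBoundary_regularize (w : V → R) (x : PathModule R V) :
    regBoundary w (regularize R V x) = regBoundary w x := by
  have : regBoundary w ∘ₗ regularize R V = regBoundary w := by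
    ext1 l
    ext1
    simp only [LinearMap.comp_apply, Finsupp.lsingle_apply, regularize_single]
    split_ifs with h
    · rfl
    · simp [regBoundary, regularize_boundary_of_not w l h]
  simpa using LinearMap.congr_fun this x

theorem regBoundary_regBoundary (w : V → R) (x : PathModule R V) :
    regBoundary w (regBoundary w x) = 0 := by
  conv_lhs => rw [show regBoundary w x = regularize R V (boundary w x) from rfl]
  rw [regBoundary_regularize]
  simp [regBoundary, boundary_boundary]

theorem push_regularize (f : V → V') (x : PathModule R V) :
    push R f (regularize R V x) = push R f x := by
  have : push R f ∘ₗ regularize R V = push R f := by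
    ext1 l
    ext1
    simp only [LinearMap.comp_apply, Finsupp.lsingle_apply, regularize_single]
    split_ifs with h
    · rfl
    · have h' : ¬ IsRegularPath (l.map f) := by
        intro h'
        exact h (((List.isChain_map f).1 h').imp fun a b hab e => hab (congrArg f e))
      simp [push, Finsupp.mapDomain_single, regularize_single, h']
  simpa using LinearMap.congr_fun this x

theorem regBoundary_push (w : V → R) (w' : V' → R) (f : V → V') (h : ∀ i, w i = w' (f i))
    (x : PathModule R V) : regBoundary w' (push R f x) = push R f (regBoundary w x) := by
  rw [show regBoundary w x = regularize R V (boundary w x) from rfl, push_regularize,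
    show push R f x = regularize R V' (Finsupp.lmapDomain R R (List.map f) x) from rfl,
    regBoundary_regularize, regBoundary, LinearMap.comp_apply, boundary_map w w' f h]
  rfl

theorem concat_single (l : List V) (l' : List V') :
    concat R V V' (Finsupp.single l 1) (Finsupp.single l' 1) =
      Finsupp.single (l.map Sum.inl ++ l'.map Sum.inr) 1 := by
  simp [concat, Finsupp.mapDomain_single]

theorem isRegular_concat (l : List V) (l' : List V') :
    IsRegularPath (l.map Sum.inl ++ l'.map Sum.inr : List (V ⊕ V')) ↔
      IsRegularPath l ∧ IsRegularPath l' := by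
  simp only [IsRegularPath, List.isChain_append, List.isChain_map]
  simp only [ne_eq, Sum.inl.injEq, Sum.inr.injEq]
  refine ⟨fun h => ⟨h.1, h.2.1⟩, fun h => ⟨h.1, h.2, ?_⟩⟩
  intro x hx y hy
  have hx := List.mem_of_mem_getLast? hx
  have hy := List.mem_of_mem_head? hy
  simp only [List.mem_map] at hx hy
  obtain ⟨a, -, rfl⟩ := hx
  obtain ⟨b, -, rfl⟩ := hy
  simp

theorem regularize_concat (u : PathModule R V) (v : PathModule R V') :
    regularize R (V ⊕ V') (concat R V V' u v) =
      concat R V V' (regularize R V u) (regularize R V' v) := by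
  have : (concat R V V').compr₂ (regularize R (V ⊕ V')) =
      (concat R V V').compl₁₂ (regularize R V) (regularize R V') := by
    ext1 l
    ext1
    ext1 l'
    ext1
    simp only [LinearMap.comp_apply, Finsupp.lsingle_apply, LinearMap.compr₂_apply,
      LinearMap.compl₁₂_apply, concat_single, regularize_single]
    have hr := isRegular_concat l l'
    by_cases h : IsRegularPath l <;> by_cases h' : IsRegularPath l' <;>
      simp only [h, h', and_self, and_false, false_and, iff_true, iff_false] at hr <;>
      simp [h, h', hr, concat_single]
  exact LinearMap.congr_fun₂ this u v

theorem boundary_concat (w : V → R) (w' : V' → R) (k : ℕ) (u : PathModule R V)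
    (hu : u ∈ Finsupp.supported R R {l : List V | l.length = k}) (v : PathModule R V') :
    boundary (Sum.elim w w') (concat R V V' u v) =
      concat R V V' (boundary w u) v + (-1 : R) ^ k • concat R V V' u (boundary w' v) := by
  have hc : ∀ (a : V) (x : PathModule R V),
      concat R V V' (cons a x) v = cons (Sum.inl a) (concat R V V' x v) := by
    intro a x
    have : (concat R V V').flip v ∘ₗ cons a = cons (Sum.inl a) ∘ₗ (concat R V V').flip v := by
      ext1 l
      ext1
      simp only [LinearMap.comp_apply, Finsupp.lsingle_apply, cons_single, LinearMap.flip_apply]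
      simp only [cons, concat, Finsupp.linearCombination_single, one_smul, Finsupp.lmapDomain_apply,
        ← Finsupp.mapDomain_comp]
      rfl
    exact LinearMap.congr_fun this x
  have hn : ∀ y : PathModule R V', concat R V V' (Finsupp.single [] 1) y =
      Finsupp.lmapDomain R R (List.map Sum.inr) y := by
    intro y
    simp [concat]
  have hs : ∀ l : List V, boundary (Sum.elim w w') (concat R V V' (Finsupp.single l 1) v) =
      concat R V V' (boundary w (Finsupp.single l 1)) v +
        (-1 : R) ^ l.length • concat R V V' (Finsupp.single l 1) (boundary w' v) := by
    intro l
    induction l with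
    | nil =>
      rw [boundary_nil, hn, hn, boundary_map w' (Sum.elim w w') Sum.inr fun _ => rfl]
      simp
    | cons a l ih =>
      have hc' : concat R V V' (Finsupp.single (a :: l) 1) (boundary w' v) =
          cons (Sum.inl a) (concat R V V' (Finsupp.single l 1) (boundary w' v)) := by
        simp only [concat, Finsupp.linearCombination_single, one_smul, Finsupp.lmapDomain_apply,
          cons, ← Finsupp.mapDomain_comp]
        rfl
      rw [hc', ← cons_single, hc, boundary_cons, ih, boundary_cons, map_sub, LinearMap.sub_apply,
        hc, map_smul, LinearMap.smul_apply]
      simp only [map_add, map_smul, Sum.elim_inl, List.length_cons, pow_succ]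
      module
  rw [Finsupp.supported_eq_span_single] at hu
  induction hu using Submodule.span_induction with
  | mem x hx =>
    obtain ⟨l, rfl, rfl⟩ := hx
    exact hs l
  | zero => simp
  | add x y _ _ hx hy =>
    simp only [map_add, LinearMap.add_apply, hx, hy, smul_add]
    abel
  | smul c x _ hx =>
    simp only [map_smul, LinearMap.smul_apply, hx, smul_add]
    rw [smul_comm]

end PathModule

/-! ### Weighted digraphs, their morphisms and their joins -/

/-- A finite non-empty digraph without loops, with a non-vanishing weight on its vertices. -/
structure WeightedDigraph (R : Type u) [CommRing R] : Type (u + 1) where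
  V : Type u
  finite : Finite V
  nonempty : Nonempty V
  graph : Digraph V
  loopless : ∀ i, ¬ graph.Adj i i
  weight : V → R
  weight_ne_zero : ∀ i, weight i ≠ 0

namespace WeightedDigraph

open PathModule

variable {R : Type u} [CommRing R]

/-- A morphism sends an edge to an edge or collapses it to a vertex, and preserves weights. -/
structure Hom (G H : WeightedDigraph R) where
  toFun : G.V → H.V
  map_adj : ∀ i j, G.graph.Adj i j → H.graph.Adj (toFun i) (toFun j) ∨ toFun i = toFun j
  map_weight : ∀ i, G.weight i = H.weight (toFun i)

/-- The edges of the join: those of `G`, those of `G'`, and all `(i, j)` with `i ∈ V`, `j ∈ V'`. -/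
inductive JoinAdj (G G' : WeightedDigraph R) : G.V ⊕ G'.V → G.V ⊕ G'.V → Prop
  | left {i j : G.V} (h : G.graph.Adj i j) : JoinAdj G G' (Sum.inl i) (Sum.inl j)
  | right {i j : G'.V} (h : G'.graph.Adj i j) : JoinAdj G G' (Sum.inr i) (Sum.inr j)
  | cross (i : G.V) (j : G'.V) : JoinAdj G G' (Sum.inl i) (Sum.inr j)

/-- The join `(G * G', w * w')`, on the disjoint union of the vertex sets. -/
abbrev join (G G' : WeightedDigraph R) : WeightedDigraph R where
  V := G.V ⊕ G'.V
  finite := by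
    have := G.finite
    have := G'.finite
    infer_instance
  nonempty := G.nonempty.map Sum.inl
  graph := ⟨JoinAdj G G'⟩
  loopless := by
    rintro (i | i) h
    · cases h with
      | left h => exact G.loopless i h
    · cases h with
      | right h => exact G'.loopless i h
  weight := Sum.elim G.weight G'.weight
  weight_ne_zero := by
    rintro (i | i)
    · exact G.weight_ne_zero i
    · exact G'.weight_ne_zero i

/-- The morphism `f * f'` of joins. -/
def Hom.join {G H G' H' : WeightedDigraph R} (f : Hom G H) (f' : Hom G' H') :
    Hom (G.join G') (H.join H') where
  toFun := Sum.map f.toFun f'.toFun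
  map_adj := by
    intro i j h
    cases h with
    | left h =>
      exact (f.map_adj _ _ h).imp (fun h => JoinAdj.left h) (fun h => congrArg Sum.inl h)
    | right h =>
      exact (f'.map_adj _ _ h).imp (fun h => JoinAdj.right h) (fun h => congrArg Sum.inr h)
    | cross i j => exact Or.inl (JoinAdj.cross _ _)
  map_weight := by
    rintro (i | i)
    · exact f.map_weight i
    · exact f'.map_weight i

/-! ### Weighted path homology -/

/-- The weighted boundary operator `∂^w` on regular paths of `G`. -/
def d (G : WeightedDigraph R) : PathModule R G.V →ₗ[R] PathModule R G.V := regBoundary G.weight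

/-- `𝓐_*(G)`: combinations of allowed elementary paths (all degrees together). -/
def allowed (G : WeightedDigraph R) : Submodule R (PathModule R G.V) :=
  Finsupp.supported R R {l : List G.V | l.IsChain G.graph.Adj}

/-- `Λ_p(V)`, `p = k - 1`: combinations of elementary paths with `k` vertices. -/
def ofLength (G : WeightedDigraph R) (k : ℕ) : Submodule R (PathModule R G.V) :=
  Finsupp.supported R R {l : List G.V | l.length = k}

/-- `Ω^w_p(G) = {v ∈ 𝓐_p(G) : ∂^w v ∈ 𝓐_{p-1}(G)}`, `p = k - 1`.  (The boundary operator lowers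
the number of vertices by one, so it is enough to ask that `∂^w v` is allowed.  For `k = 0` this
is `R`, spanned by the empty path.) -/
def Omega (G : WeightedDigraph R) (k : ℕ) : Submodule R (PathModule R G.V) :=
  (G.ofLength k ⊓ G.allowed) ⊓ G.allowed.comap G.d

/-- The cycles `Ker (∂^w | Ω^w_p)`, `p = k - 1`. -/
def cycles (G : WeightedDigraph R) (k : ℕ) : Submodule R (PathModule R G.V) :=
  G.Omega k ⊓ LinearMap.ker G.d

/-- The boundaries `Im (∂^w | Ω^w_{p+1})`, `p = k - 1`. -/
def boundaries (G : WeightedDigraph R) (k : ℕ) : Submodule R (PathModule R G.V) :=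
  (G.Omega (k + 1)).map G.d

/-- The homology `H_p(G, w; R)`, `p = k - 1 ≥ -1`, of the augmented complex
`⋯ → Ω^w_1(G) → Ω^w_0(G) → R → 0`. -/
abbrev Homology (G : WeightedDigraph R) (k : ℕ) : Type u :=
  Subquotient (G.cycles k) (G.boundaries k)

theorem regularize_of_allowed (G : WeightedDigraph R) {x : PathModule R G.V} (hx : x ∈ G.allowed) :
    regularize R G.V x = x := by
  rw [allowed, Finsupp.supported_eq_span_single] at hx
  induction hx using Submodule.span_induction with
  | mem x hx =>
    obtain ⟨l, hl, rfl⟩ := hx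
    have : IsRegularPath l := List.IsChain.imp (fun a b hab e => G.loopless a (by simpa [e] using hab)) hl
    simp [regularize_single, this]
  | zero => simp
  | add x y _ _ hx hy => simp [hx, hy]
  | smul c x _ hx => simp [hx]

theorem d_ofLength (G : WeightedDigraph R) {k : ℕ} {x : PathModule R G.V}
    (hx : x ∈ G.ofLength (k + 1)) : G.d x ∈ G.ofLength k := by
  rw [ofLength, Finsupp.supported_eq_span_single] at hx
  induction hx using Submodule.span_induction with
  | mem x hx =>
    obtain ⟨l, hl, rfl⟩ := hx
    simp only [d, regBoundary, boundary, LinearMap.comp_apply, Finsupp.linearCombination_single,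
      one_smul, map_sum, map_smul, regularize_single]
    refine Submodule.sum_mem _ fun q _ => Submodule.smul_mem _ _ ?_
    split_ifs
    · refine Finsupp.single_mem_supported R _ ?_
      have : l.length = k + 1 := hl
      have := q.2
      simp only [Set.mem_ofPred_eq, List.length_eraseIdx]
      split_ifs <;> omega
    · exact zero_mem _
  | zero => simp
  | add x y _ _ hx hy => rw [map_add]; exact add_mem hx hy
  | smul c x _ hx => rw [map_smul]; exact Submodule.smul_mem _ _ hx

theorem boundaries_le_cycles (G : WeightedDigraph R) (k : ℕ) : G.boundaries k ≤ G.cycles k := by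
  rintro _ ⟨x, hx, rfl⟩
  have h0 : G.d (G.d x) = 0 := regBoundary_regBoundary _ _
  refine ⟨⟨⟨G.d_ofLength hx.1.1, hx.2⟩, ?_⟩, h0⟩
  refine Submodule.mem_comap.2 ?_
  rw [h0]
  exact zero_mem _

/-! Functoriality. -/

theorem push_allowed {G H : WeightedDigraph R} (f : Hom G H) {x : PathModule R G.V}
    (hx : x ∈ G.allowed) : push R f.toFun x ∈ H.allowed := by
  rw [allowed, Finsupp.supported_eq_span_single] at hx
  induction hx using Submodule.span_induction with
  | mem x hx =>
    obtain ⟨l, hl, rfl⟩ := hx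
    simp only [push, LinearMap.comp_apply, Finsupp.lmapDomain_apply, Finsupp.mapDomain_single,
      regularize_single]
    split_ifs with h
    · refine Finsupp.single_mem_supported R _ ?_
      have h1 : l.IsChain fun a b => f.toFun a ≠ f.toFun b := (List.isChain_map _).1 h
      refine (List.isChain_map _).2 ?_
      have h2 := List.isChain_iff_getElem.1 h1
      have h3 := List.isChain_iff_getElem.1 hl
      exact List.isChain_iff_getElem.2 fun i hi =>
        (f.map_adj _ _ (h3 i hi)).resolve_right (h2 i hi)
    · exact zero_mem _
  | zero => simp
  | add x y _ _ hx hy => rw [map_add]; exact add_mem hx hy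
  | smul c x _ hx => rw [map_smul]; exact Submodule.smul_mem _ _ hx

theorem push_ofLength {G H : WeightedDigraph R} (f : Hom G H) {k : ℕ} {x : PathModule R G.V}
    (hx : x ∈ G.ofLength k) : push R f.toFun x ∈ H.ofLength k := by
  rw [ofLength, Finsupp.supported_eq_span_single] at hx
  induction hx using Submodule.span_induction with
  | mem x hx =>
    obtain ⟨l, hl, rfl⟩ := hx
    simp only [push, LinearMap.comp_apply, Finsupp.lmapDomain_apply, Finsupp.mapDomain_single,
      regularize_single]
    split_ifs with h
    · refine Finsupp.single_mem_supported R _ ?_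
      simpa using hl
    · exact zero_mem _
  | zero => simp
  | add x y _ _ hx hy => rw [map_add]; exact add_mem hx hy
  | smul c x _ hx => rw [map_smul]; exact Submodule.smul_mem _ _ hx

theorem d_push {G H : WeightedDigraph R} (f : Hom G H) (x : PathModule R G.V) :
    H.d (push R f.toFun x) = push R f.toFun (G.d x) :=
  regBoundary_push _ _ _ f.map_weight x

theorem push_Omega {G H : WeightedDigraph R} (f : Hom G H) {k : ℕ} {x : PathModule R G.V}
    (hx : x ∈ G.Omega k) : push R f.toFun x ∈ H.Omega k := by
  refine ⟨⟨push_ofLength f hx.1.1, push_allowed f hx.1.2⟩, ?_⟩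
  refine Submodule.mem_comap.2 ?_
  rw [d_push]
  exact push_allowed f hx.2

theorem push_cycles {G H : WeightedDigraph R} (f : Hom G H) (k : ℕ) :
    ∀ x ∈ G.cycles k, push R f.toFun x ∈ H.cycles k := by
  intro x hx
  refine ⟨push_Omega f hx.1, ?_⟩
  refine LinearMap.mem_ker.2 ?_
  rw [d_push, show G.d x = 0 from hx.2, map_zero]

/-- The induced homomorphism `f_* : H_p(G, w; R) → H_p(H, w'; R)`, `p = k - 1`,
`f_* [v] = [f_# v]`. -/
def Hom.homologyMap {G H : WeightedDigraph R} (f : Hom G H) (k : ℕ) :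
    G.Homology k →ₗ[R] H.Homology k :=
  Subquotient.map (push R f.toFun) (push_cycles f k) (by
    rintro _ ⟨y, hy, rfl⟩
    exact ⟨push R f.toFun y, push_Omega f hy, d_push f y⟩)

/-! ### The cross product for the join -/

theorem concat_allowed {G G' : WeightedDigraph R} {x : PathModule R G.V} {y : PathModule R G'.V}
    (hx : x ∈ G.allowed) (hy : y ∈ G'.allowed) :
    concat R G.V G'.V x y ∈ (G.join G').allowed := by
  rw [allowed, Finsupp.supported_eq_span_single] at hx hy
  induction hx using Submodule.span_induction with
  | mem x hx =>
    obtain ⟨l, hl, rfl⟩ := hx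
    induction hy using Submodule.span_induction with
    | mem y hy =>
      obtain ⟨l', hl', rfl⟩ := hy
      rw [concat_single]
      refine Finsupp.single_mem_supported R _ ?_
      refine List.IsChain.append ?_ ?_ ?_
      · exact (List.isChain_map _).2 (List.IsChain.imp (fun a b h => JoinAdj.left h) hl)
      · exact (List.isChain_map _).2 (List.IsChain.imp (fun a b h => JoinAdj.right h) hl')
      · intro a ha b hb
        have ha := List.mem_of_mem_getLast? ha
        have hb := List.mem_of_mem_head? hb
        simp only [List.mem_map] at ha hb
        obtain ⟨i, -, rfl⟩ := ha
        obtain ⟨j, -, rfl⟩ := hb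
        exact JoinAdj.cross i j
    | zero => simp
    | add x y _ _ hx hy => rw [map_add]; exact add_mem hx hy
    | smul c x _ hx => rw [map_smul]; exact Submodule.smul_mem _ _ hx
  | zero => simp
  | add x y _ _ hx hy => rw [map_add, LinearMap.add_apply]; exact add_mem hx hy
  | smul c x _ hx => rw [map_smul, LinearMap.smul_apply]; exact Submodule.smul_mem _ _ hx

theorem concat_ofLength {G G' : WeightedDigraph R} {a b k : ℕ} (hk : a + b = k)
    {x : PathModule R G.V} {y : PathModule R G'.V}
    (hx : x ∈ G.ofLength a) (hy : y ∈ G'.ofLength b) :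
    concat R G.V G'.V x y ∈ (G.join G').ofLength k := by
  rw [ofLength, Finsupp.supported_eq_span_single] at hx hy
  induction hx using Submodule.span_induction with
  | mem x hx =>
    obtain ⟨l, hl, rfl⟩ := hx
    induction hy using Submodule.span_induction with
    | mem y hy =>
      obtain ⟨l', hl', rfl⟩ := hy
      rw [concat_single]
      refine Finsupp.single_mem_supported R _ ?_
      simp only [Set.mem_ofPred_eq] at hl hl'
      simp [hl, hl', hk]
    | zero => simp
    | add x y _ _ hx hy => rw [map_add]; exact add_mem hx hy
    | smul c x _ hx => rw [map_smul]; exact Submodule.smul_mem _ _ hx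
  | zero => simp
  | add x y _ _ hx hy => rw [map_add, LinearMap.add_apply]; exact add_mem hx hy
  | smul c x _ hx => rw [map_smul, LinearMap.smul_apply]; exact Submodule.smul_mem _ _ hx

/-- The product rule. -/
theorem d_concat {G G' : WeightedDigraph R} {a b : ℕ} {x : PathModule R G.V}
    {y : PathModule R G'.V} (hx : x ∈ G.Omega a) (hy : y ∈ G'.Omega b) :
    (G.join G').d (concat R G.V G'.V x y) =
      concat R G.V G'.V (G.d x) y + (-1 : R) ^ a • concat R G.V G'.V x (G'.d y) := by
  have h := congrArg (regularize R (G.V ⊕ G'.V))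
    (boundary_concat G.weight G'.weight a x hx.1.1 y)
  rw [map_add, map_smul, regularize_concat, regularize_concat, G.regularize_of_allowed hx.1.2,
    G'.regularize_of_allowed hy.1.2] at h
  exact h

theorem concat_Omega {G G' : WeightedDigraph R} {a b k : ℕ} (hk : a + b = k)
    {x : PathModule R G.V} {y : PathModule R G'.V} (hx : x ∈ G.Omega a) (hy : y ∈ G'.Omega b) :
    concat R G.V G'.V x y ∈ (G.join G').Omega k := by
  refine ⟨⟨concat_ofLength hk hx.1.1 hy.1.1, concat_allowed hx.1.2 hy.1.2⟩, ?_⟩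
  refine Submodule.mem_comap.2 ?_
  rw [d_concat hx hy]
  exact add_mem (concat_allowed hx.2 hy.1.2) (Submodule.smul_mem _ _ (concat_allowed hx.1.2 hy.2))

theorem concat_cycles {G G' : WeightedDigraph R} {a b k : ℕ} (hk : a + b = k)
    {x : PathModule R G.V} {y : PathModule R G'.V} (hx : x ∈ G.cycles a) (hy : y ∈ G'.cycles b) :
    concat R G.V G'.V x y ∈ (G.join G').cycles k := by
  refine ⟨concat_Omega hk hx.1 hy.1, ?_⟩
  have h1 : G.d x = 0 := hx.2
  have h2 : G'.d y = 0 := hy.2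
  refine LinearMap.mem_ker.2 ?_
  rw [d_concat hx.1 hy.1, h1, h2]
  simp

theorem concat_boundaries_left {G G' : WeightedDigraph R} {a b k : ℕ} (hk : a + b = k)
    {x : PathModule R G.V} {y : PathModule R G'.V} (hx : x ∈ G.boundaries a)
    (hy : y ∈ G'.cycles b) : concat R G.V G'.V x y ∈ (G.join G').boundaries k := by
  obtain ⟨z, hz, rfl⟩ := hx
  refine ⟨concat R G.V G'.V z y, concat_Omega (by omega) hz hy.1, ?_⟩
  have h2 : G'.d y = 0 := hy.2
  rw [d_concat hz hy.1, h2]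
  simp

theorem concat_boundaries_right {G G' : WeightedDigraph R} {a b k : ℕ} (hk : a + b = k)
    {x : PathModule R G.V} {y : PathModule R G'.V} (hx : x ∈ G.cycles a)
    (hy : y ∈ G'.boundaries b) : concat R G.V G'.V x y ∈ (G.join G').boundaries k := by
  obtain ⟨z, hz, rfl⟩ := hy
  refine ⟨(-1 : R) ^ a • concat R G.V G'.V x z,
    Submodule.smul_mem _ _ (concat_Omega (by omega) hx.1 hz), ?_⟩
  have h1 : G.d x = 0 := hx.2
  rw [map_smul, d_concat hx.1 hz, h1]
  simp [smul_smul, ← mul_pow]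

/-- The product `H_p(G, w; R) ⊗ H_q(G', w'; R) → H_{p+q+1}(G * G', w * w'; R)`,
`[u] ⊗ [v] ↦ [uv]`, where `p = a - 1` and `q = b - 1`. -/
def homologyCross (G G' : WeightedDigraph R) {a b k : ℕ} (hk : a + b = k) :
    G.Homology a ⊗[R] G'.Homology b →ₗ[R] (G.join G').Homology k :=
  Subquotient.cross (concat R G.V G'.V) (fun _ hx _ hy => concat_cycles hk hx hy)
    (fun _ hx _ hy => concat_boundaries_left hk hx hy)
    (fun _ hx _ hy => concat_boundaries_right hk hx hy)

/-! ### The terms and the maps of the Künneth sequence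

In degree `r`, i.e. with `r + 1` vertices, `p, q ≥ -1` and `p + q = r - 1` become
`a + b = r + 1` with `a = p + 1`, `b = q + 1`; in the `Tor` term, which involves `H_p` and
`H_{q-1}`, the summand `q = -1` vanishes as `H_{-2} = 0`, and the others are indexed by
`a + b = r` with `a = p + 1`, `b = q`. -/

/-- `⨁_{p+q=r-1} H_p(G, w; R) ⊗ H_q(G', w'; R)`. -/
abbrev KunnethTensor (G G' : WeightedDigraph R) (r : ℕ) : Type u :=
  ⨁ i : Finset.HasAntidiagonal.antidiagonal (r + 1), (G.Homology i.1.1 ⊗[R] G'.Homology i.1.2)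

/-- `Tor₁^R(M, N)`. -/
abbrev TorOne (R : Type u) [CommRing R] (M N : Type u) [AddCommGroup M] [Module R M]
    [AddCommGroup N] [Module R N] : Type u :=
  ((Tor (ModuleCat.{u} R) 1).obj (ModuleCat.of R M)).obj (ModuleCat.of R N)

/-- `Tor₁^R(f, g)`. -/
def torMap {M N M' N' : Type u} [AddCommGroup M] [Module R M] [AddCommGroup N] [Module R N]
    [AddCommGroup M'] [Module R M'] [AddCommGroup N'] [Module R N']
    (f : M →ₗ[R] M') (g : N →ₗ[R] N') : TorOne R M N →ₗ[R] TorOne R M' N' :=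
  (((Tor (ModuleCat.{u} R) 1).map (ModuleCat.ofHom f)).app (ModuleCat.of R N) ≫
    ((Tor (ModuleCat.{u} R) 1).obj (ModuleCat.of R M')).map (ModuleCat.ofHom g)).hom

/-- `⨁_{p+q=r-1} Tor_R(H_p(G, w; R), H_{q-1}(G', w'; R))`. -/
abbrev KunnethTor (G G' : WeightedDigraph R) (r : ℕ) : Type u :=
  ⨁ i : Finset.HasAntidiagonal.antidiagonal r, TorOne R (G.Homology i.1.1) (G'.Homology i.1.2)

/-- The first map of the Künneth sequence, given by the products `[u] ⊗ [v] ↦ [uv]`. -/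
def kunnethCross (G G' : WeightedDigraph R) (r : ℕ) :
    KunnethTensor G G' r →ₗ[R] (G.join G').Homology (r + 1) :=
  DirectSum.toModule R _ _ fun i => homologyCross G G' (Finset.HasAntidiagonal.mem_antidiagonal.1 i.2)

/-- The map `⨁ f_* ⊗ f'_*` induced on the tensor terms. -/
def kunnethTensorMap {G H G' H' : WeightedDigraph R} (f : Hom G H) (f' : Hom G' H') (r : ℕ) :
    KunnethTensor G G' r →ₗ[R] KunnethTensor H H' r :=
  DirectSum.lmap fun i : Finset.HasAntidiagonal.antidiagonal (r + 1) =>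
    TensorProduct.map (f.homologyMap i.1.1) (f'.homologyMap i.1.2)

/-- The map `⨁ Tor(f_*, f'_*)` induced on the `Tor` terms. -/
def kunnethTorMap {G H G' H' : WeightedDigraph R} (f : Hom G H) (f' : Hom G' H') (r : ℕ) :
    KunnethTor G G' r →ₗ[R] KunnethTor H H' r :=
  DirectSum.lmap fun i : Finset.HasAntidiagonal.antidiagonal r =>
    torMap (f.homologyMap i.1.1) (f'.homologyMap i.1.2)

end WeightedDigraph

/-- `0 → A → B → C → 0` is exact and splits. -/
structure IsSplitShortExact {R A B C : Type u} [CommRing R] [AddCommGroup A] [Module R A]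
    [AddCommGroup B] [Module R B] [AddCommGroup C] [Module R C]
    (f : A →ₗ[R] B) (g : B →ₗ[R] C) : Prop where
  injective : Function.Injective f
  exact : Function.Exact f g
  surjective : Function.Surjective g
  split : ∃ s : C →ₗ[R] B, g ∘ₗ s = LinearMap.id

end

/-! Count degrees by numbers of vertices. An edge of the join never leads from `V'` back to `V`, so
an allowed path of `G * G'` is uniquely an allowed path of `G` followed by one of `G'`: the allowed
paths of the join form `A ⊗ A'`, where `A`, `A'` are the allowed paths of the factors. The boundary
obeys the Leibniz rule. If it maps `t ∈ A ⊗ A'` back into `A ⊗ A'`, then projecting one factor at a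
time away from the allowed paths shows that both partial obstructions of `t` vanish. Submodules of
free modules over a PID are flat, so `t` lies in the tensor product of the two kernels, that is, in
`⨁ Ω_a(G) ⊗ Ω_b(G')`. Concatenation is therefore an isomorphism from the tensor product complex onto
`Ω(G * G')` (`exists_totalConcat`, `totalConcat_eq_zero`, `d_totalConcat`).

What remains is the algebraic Künneth formula for complexes of projective modules, arranged so that
`β` is visibly natural. With `0 → B' → Z' → H' → 0` as resolution, `Tor₁(H_a, H'_b)` is the kernel
of `H_a ⊗ B'_b → H_a ⊗ Z'_b`, and it embeds in `Q_a ⊗ B'_b` with `Q = C / B` (`torInto`). The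
component of `β` on the class of a cycle `x` is the element of `Tor` whose image there is `(κ ⊗
δ)(x_{a,b+1})` (`torPart`). Nothing in this formula is chosen and the embedding is injective, so `β`
is determined and commutes with morphisms.

Exactness is proved on chains in `exists_cycle_tensor` and `exists_cycle_torPart`. For the
splitting, projectivity of the boundaries extends `Z → H` to `ρ : C → H`; then `ρ ⊗ ρ'` kills
boundaries and gives a left inverse of `α`, which depends on choices. -/

noncomputable section

set_option linter.unusedSectionVars false

/-! ### Short exact sequences with projective left and middle terms as projective resolutions. -/

namespace TwoTermResolution

variable {R : Type u} [CommRing R]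

/-- The objects of the complex `⋯ → 0 → S → F`. -/
def obj (S F : ModuleCat.{u} R) : ℕ → ModuleCat.{u} R
  | 0 => F
  | 1 => S
  | _ + 2 => ModuleCat.of R PUnit

/-- The differentials of the complex `⋯ → 0 → S → F`. -/
def diff {S F : ModuleCat.{u} R} (i : S ⟶ F) : ∀ n, obj S F (n + 1) ⟶ obj S F n
  | 0 => i
  | _ + 1 => 0

/-- The complex `⋯ → 0 → S → F`. -/
def cplx {S F : ModuleCat.{u} R} (i : S ⟶ F) : ChainComplex (ModuleCat.{u} R) ℕ :=
  ChainComplex.of (obj S F) (diff i) (by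
    intro n
    have : diff i (n + 1) = 0 := by cases n <;> rfl
    rw [this, Limits.zero_comp])

theorem cplx_d_one_zero {S F : ModuleCat.{u} R} (i : S ⟶ F) : (cplx i).d 1 0 = i :=
  ChainComplex.of_d (obj S F) (diff i) 0

theorem cplx_d_succ {S F : ModuleCat.{u} R} (i : S ⟶ F) (n : ℕ) :
    (cplx i).d (n + 2) (n + 1) = 0 :=
  ChainComplex.of_d (obj S F) (diff i) (n + 1)

theorem isZero_obj (S F : ModuleCat.{u} R) (n : ℕ) : Limits.IsZero (obj S F (n + 2)) :=
  ModuleCat.isZero_of_subsingleton (ModuleCat.of R PUnit)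

/-- The morphism of complexes induced by a commutative square. -/
def cplxMap {S F S' F' : ModuleCat.{u} R} {i : S ⟶ F} {i' : S' ⟶ F'} (s : S ⟶ S') (t : F ⟶ F')
    (h : s ≫ i' = i ≫ t) : cplx i ⟶ cplx i' :=
  ChainComplex.ofHom
    (fun | 0 => t
         | 1 => s
         | _ + 2 => 0)
    (by
      intro n
      rcases n with _ | n
      · have h₁ := cplx_d_one_zero i
        have h₂ := cplx_d_one_zero i'
        refine (congrArg (s ≫ ·) h₂).trans (h.trans ?_)
        exact (congrArg (· ≫ t) h₁).symm
      · exact ((isZero_obj S F n).eq_of_src _ _))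

/-- The projective resolution `0 → S → F → N → 0`. -/
def resolution {S F N : ModuleCat.{u} R} (i : S ⟶ F) (p : F ⟶ N) [Projective S] [Projective F]
    [Mono i] [Epi p] (w : i ≫ p = 0) (h : (ShortComplex.mk i p w).Exact) :
    ProjectiveResolution N where
  complex := cplx i
  projective n := by
    match n with
    | 0 => exact inferInstanceAs (Projective F)
    | 1 => exact inferInstanceAs (Projective S)
    | n + 2 => exact (isZero_obj S F n).projective
  π := (ChainComplex.toSingle₀Equiv _ _).symm ⟨p, by rw [cplx_d_one_zero]; exact w⟩
  quasiIso := ⟨fun n => by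
    rcases n with _ | n
    · rw [ChainComplex.quasiIsoAt₀_iff, ShortComplex.quasiIso_iff_of_zeros']
      · refine (ShortComplex.exact_and_epi_g_iff_of_iso ?_).2 ⟨h, inferInstanceAs (Epi p)⟩
        exact ShortComplex.isoMk (Iso.refl _) (Iso.refl _) (Iso.refl _)
          (by
            refine (Category.id_comp i).trans ?_
            refine Eq.trans ?_ (Category.comp_id _).symm
            exact (cplx_d_one_zero i).symm)
          (by
            refine (Category.id_comp p).trans ?_
            exact (Category.comp_id p).symm)
      all_goals rfl
    · rw [quasiIsoAt_iff_exactAt']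
      · rw [HomologicalComplex.exactAt_iff' _ (n + 1 + 1) (n + 1) n (by simp) (by simp)]
        rcases n with _ | n
        -- In degree 1 the incoming differential is zero, so exactness is injectivity of `S → F`. In
        -- higher degrees the object itself is zero.
        · refine (ShortComplex.exact_iff_mono _ ?_).2 ?_
          · exact cplx_d_succ i 0
          · have := cplx_d_one_zero i
            change Mono ((cplx i).d 1 0)
            rw [this]; exact ‹Mono i›
        · exact ShortComplex.exact_of_isZero_X₂ _ (isZero_obj S F n)
      · apply ChainComplex.exactAt_succ_single_obj⟩

end TwoTermResolution

/-! ### First homology of a complex whose second differential vanishes. -/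

section HomologyEmb

variable {R : Type u} [CommRing R] {K L : ChainComplex (ModuleCat.{u} R) ℕ}

/-- If `d₂ = 0`, the first homology is the submodule of cycles. -/
def homologyEmb (K : ChainComplex (ModuleCat.{u} R) ℕ) (hK : K.d 2 1 = 0) :
    K.homology 1 ⟶ K.X 1 :=
  (K.isoHomologyπ 2 1 (by simp) hK).inv ≫ K.iCycles 1

instance (hK : K.d 2 1 = 0) : Mono (homologyEmb K hK) := by
  unfold homologyEmb; infer_instance

theorem homologyEmb_naturality (hK : K.d 2 1 = 0) (hL : L.d 2 1 = 0) (φ : K ⟶ L) :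
    HomologicalComplex.homologyMap φ 1 ≫ homologyEmb L hL = homologyEmb K hK ≫ φ.f 1 := by
  unfold homologyEmb
  rw [← cancel_epi (K.isoHomologyπ 2 1 (by simp) hK).hom]
  have h1 : (K.isoHomologyπ 2 1 (by simp) hK).hom = K.homologyπ 1 := rfl
  have h2 : L.homologyπ 1 ≫ (L.isoHomologyπ 2 1 (by simp) hL).inv = 𝟙 _ := by simp
  rw [h1, HomologicalComplex.homologyπ_naturality_assoc, reassoc_of% h2, ← h1]
  simp

theorem homologyEmb_exact (hK : K.d 2 1 = 0) :
    Function.Exact (homologyEmb K hK) (K.d 1 0) := by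
  have hw : homologyEmb K hK ≫ K.d 1 0 = 0 := by simp [homologyEmb]
  refine (ShortComplex.ShortExact.moduleCat_exact_iff_function_exact
    (ShortComplex.mk _ _ hw)).1 ?_
  refine ShortComplex.exact_of_iso (S₁ := ShortComplex.mk (K.iCycles 1) (K.d 1 0) (by simp))
    (ShortComplex.isoMk (K.isoHomologyπ 2 1 (by simp) hK) (Iso.refl _) (Iso.refl _)
      (by simp [homologyEmb]) (by simp)) ?_
  exact ShortComplex.exact_of_f_is_kernel _ (K.cyclesIsKernel 1 0 (by simp))

end HomologyEmb

/-! ### `Tor₁(M, N)` as the kernel of `M ⊗ S → M ⊗ F`, naturally in both variables. -/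

section TorEmb

open MonoidalCategory TwoTermResolution

variable {R : Type u} [CommRing R]

/-- `0 → S → F → N → 0` is a projective resolution of `N` of length one. -/
structure IsShortResolution {S F N : ModuleCat.{u} R} (i : S ⟶ F) (p : F ⟶ N) : Prop where
  projS : Projective S
  projF : Projective F
  mono : Mono i
  epi : Epi p
  w : i ≫ p = 0
  exact : (ShortComplex.mk i p w).Exact

variable {M S F N M' S' F' N' : ModuleCat.{u} R} {i : S ⟶ F} {p : F ⟶ N} {i' : S' ⟶ F'}
  {p' : F' ⟶ N'}

/-- The projective resolution given by `0 → S → F → N → 0`. -/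
def IsShortResolution.toRes (h : IsShortResolution i p) : ProjectiveResolution N :=
  haveI := h.projS
  haveI := h.projF
  haveI := h.mono
  haveI := h.epi
  resolution i p h.w h.exact

/-- Makes `homologyEmb` applicable to the complex that computes `Tor`. -/
theorem tensor_cplx_d (M : ModuleCat.{u} R) (i : S ⟶ F) :
    ((((tensoringLeft (ModuleCat.{u} R)).obj M).mapHomologicalComplex
      (ComplexShape.down ℕ)).obj (cplx i)).d 2 1 = 0 :=
  (congrArg (((tensoringLeft (ModuleCat.{u} R)).obj M).map) (cplx_d_succ i 0)).trans
    (Functor.map_zero _ _ _)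

/-- The embedding of `Tor₁(M, N)` into `M ⊗ S` when `0 → S → F → N → 0` is a projective
resolution. -/
def torEmbCat (M : ModuleCat.{u} R) (h : IsShortResolution i p) :
    ((Tor (ModuleCat.{u} R) 1).obj M).obj N ⟶ M ⊗ S :=
  (h.toRes.isoLeftDerivedObj ((tensoringLeft (ModuleCat.{u} R)).obj M) 1).hom ≫
    homologyEmb _ (tensor_cplx_d M i)

instance (h : IsShortResolution i p) : Mono (torEmbCat M h) := by
  have h₁ : Mono (homologyEmb _ (tensor_cplx_d M i)) := inferInstance
  have h₂ : IsIso (h.toRes.isoLeftDerivedObj ((tensoringLeft (ModuleCat.{u} R)).obj M) 1).hom :=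
    Iso.isIso_hom _
  exact @mono_comp _ _ _ _ _ _ (@IsIso.mono_of_iso _ _ _ _ _ h₂) _ h₁

theorem torEmbCat_exact (h : IsShortResolution i p) :
    Function.Exact (torEmbCat M h) (M ◁ i) := by
  have hd : (((((tensoringLeft (ModuleCat.{u} R)).obj M).mapHomologicalComplex
      (ComplexShape.down ℕ)).obj (cplx i)).d 1 0 : _) = M ◁ i :=
    congrArg (((tensoringLeft (ModuleCat.{u} R)).obj M).map) (cplx_d_one_zero i)
  intro y
  refine ((Iff.of_eq (congrArg (fun φ => φ.hom y = 0) hd)).symm.trans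
    (homologyEmb_exact (tensor_cplx_d M i) y)).trans ⟨?_, ?_⟩
  · rintro ⟨z, rfl⟩
    let e := h.toRes.isoLeftDerivedObj ((tensoringLeft (ModuleCat.{u} R)).obj M) 1
    exact ⟨e.inv.hom z, congrArg (homologyEmb _ (tensor_cplx_d M i)).hom
      (LinearMap.congr_fun (congrArg ModuleCat.Hom.hom e.inv_hom_id) z)⟩
  · rintro ⟨z, rfl⟩
    exact ⟨(h.toRes.isoLeftDerivedObj ((tensoringLeft (ModuleCat.{u} R)).obj M) 1).hom.hom z, rfl⟩

/-- `Tor` derives `M ⊗ -`, so a map in `M` is a natural transformation between the derived functors;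
one resolution of `N` serves both sides. -/
theorem torEmbCat_map_left (h : IsShortResolution i p) (f : M ⟶ M') :
    ((Tor (ModuleCat.{u} R) 1).map f).app N ≫ torEmbCat M' h = torEmbCat M h ≫ f ▷ S := by
  have h1 := ProjectiveResolution.leftDerived_app_eq
    ((tensoringLeft (ModuleCat.{u} R)).map f) h.toRes 1
  have h2 := homologyEmb_naturality (tensor_cplx_d M i) (tensor_cplx_d M' i)
    ((NatTrans.mapHomologicalComplex ((tensoringLeft (ModuleCat.{u} R)).map f)
      (ComplexShape.down ℕ)).app (cplx i))
  refine (congrArg (· ≫ torEmbCat M' h) h1).trans ?_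
  refine (Category.assoc _ _ _).trans ?_
  refine Eq.trans (congrArg (_ ≫ ·) ?_) ((congrArg (_ ≫ ·) h2).trans (Category.assoc _ _ _).symm)
  refine (Category.assoc _ _ _).trans ?_
  exact congrArg (_ ≫ ·) (Iso.inv_hom_id_assoc _ _)

/-- A derived functor may be evaluated on `g` through any lift of `g` to the resolutions; here the
lift is the pair `s`, `t`. -/
theorem torEmbCat_map_right (h : IsShortResolution i p) (h' : IsShortResolution i' p')
    (s : S ⟶ S') (t : F ⟶ F') (g : N ⟶ N') (hs : s ≫ i' = i ≫ t) (ht : t ≫ p' = p ≫ g) :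
    ((Tor (ModuleCat.{u} R) 1).obj M).map g ≫ torEmbCat M h' = torEmbCat M h ≫ M ◁ s := by
  have h1 := ProjectiveResolution.isoLeftDerivedObj_hom_naturality g h.toRes h'.toRes
    (cplxMap s t hs) ht ((tensoringLeft (ModuleCat.{u} R)).obj M) 1
  have h2 := homologyEmb_naturality (tensor_cplx_d M i) (tensor_cplx_d M i')
    ((((tensoringLeft (ModuleCat.{u} R)).obj M).mapHomologicalComplex
      (ComplexShape.down ℕ)).map (cplxMap s t hs))
  refine (Category.assoc _ _ _).symm.trans ?_
  refine (congrArg (· ≫ homologyEmb _ (tensor_cplx_d M i')) h1).trans ?_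
  refine (Category.assoc _ _ _).trans ?_
  exact (congrArg (_ ≫ ·) h2).trans (Category.assoc _ _ _).symm

end TorEmb

/-! ### The same embedding in the language of linear maps. -/

section TorEmbLinear

open MonoidalCategory WeightedDigraph

variable {R : Type u} [CommRing R] {M S F N M' S' F' N' : Type u}
  [AddCommGroup M] [Module R M] [AddCommGroup S] [Module R S] [AddCommGroup F] [Module R F]
  [AddCommGroup N] [Module R N] [AddCommGroup M'] [Module R M'] [AddCommGroup S'] [Module R S']
  [AddCommGroup F'] [Module R F'] [AddCommGroup N'] [Module R N']

theorem isShortResolution_ofHom [Module.Projective R S] [Module.Projective R F]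
    {i : S →ₗ[R] F} {p : F →ₗ[R] N} (hi : Function.Injective i) (hp : Function.Surjective p)
    (hip : Function.Exact i p) : IsShortResolution (ModuleCat.ofHom i) (ModuleCat.ofHom p) where
  projS := (IsProjective.iff_projective S).1 inferInstance
  projF := (IsProjective.iff_projective F).1 inferInstance
  mono := (ModuleCat.mono_iff_injective _).2 hi
  epi := (ModuleCat.epi_iff_surjective _).2 hp
  w := by
    ext x
    exact hip.apply_apply_eq_zero x
  exact := (ShortComplex.ShortExact.moduleCat_exact_iff_function_exact _).2 hip

/-- The embedding of `Tor₁(M, N)` into `M ⊗ S` when `0 → S → F → N → 0` is a projective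
resolution. -/
def torEmb (M : Type u) [AddCommGroup M] [Module R M] {i : S →ₗ[R] F} {p : F →ₗ[R] N}
    (h : IsShortResolution (ModuleCat.ofHom i) (ModuleCat.ofHom p)) :
    TorOne R M N →ₗ[R] M ⊗[R] S :=
  (torEmbCat (ModuleCat.of R M) h).hom

variable {i : S →ₗ[R] F} {p : F →ₗ[R] N} {i' : S' →ₗ[R] F'} {p' : F' →ₗ[R] N'}

theorem torEmb_injective (h : IsShortResolution (ModuleCat.ofHom i) (ModuleCat.ofHom p)) :
    Function.Injective (torEmb M h) :=
  (ModuleCat.mono_iff_injective (torEmbCat (ModuleCat.of R M) h)).1 inferInstance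

theorem torEmb_exact (h : IsShortResolution (ModuleCat.ofHom i) (ModuleCat.ofHom p)) :
    Function.Exact (torEmb M h) (i.lTensor M) :=
  torEmbCat_exact (M := ModuleCat.of R M) h

theorem torEmb_torMap (h : IsShortResolution (ModuleCat.ofHom i) (ModuleCat.ofHom p))
    (h' : IsShortResolution (ModuleCat.ofHom i') (ModuleCat.ofHom p'))
    (f : M →ₗ[R] M') (s : S →ₗ[R] S') (t : F →ₗ[R] F') (g : N →ₗ[R] N')
    (hs : i' ∘ₗ s = t ∘ₗ i) (ht : p' ∘ₗ t = g ∘ₗ p) :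
    torEmb M' h' ∘ₗ torMap f g = TensorProduct.map f s ∘ₗ torEmb M h := by
  have h₁ := torEmbCat_map_left h (ModuleCat.ofHom f)
  have h₂ := torEmbCat_map_right (M := ModuleCat.of R M') h h' (ModuleCat.ofHom s)
    (ModuleCat.ofHom t) (ModuleCat.ofHom g) (by ext x; exact LinearMap.congr_fun hs x)
    (by ext x; exact LinearMap.congr_fun ht x)
  ext x
  refine (LinearMap.congr_fun (congrArg ModuleCat.Hom.hom h₂) _).trans ?_
  refine (congrArg (s.lTensor M') (LinearMap.congr_fun (congrArg ModuleCat.Hom.hom h₁) x)).trans ?_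
  change s.lTensor M' (f.rTensor S (torEmb M h x)) = _
  rw [← LinearMap.comp_apply, LinearMap.lTensor_comp_rTensor]
  rfl

end TorEmbLinear

/-! ### Tensor products of kernels under flatness. -/

section FlatTensor

variable {R : Type u} [CommRing R] {M M' N N' P P' : Type u} [AddCommGroup M] [Module R M]
  [AddCommGroup M'] [Module R M'] [AddCommGroup N] [Module R N] [AddCommGroup N'] [Module R N']
  [AddCommGroup P] [Module R P] [AddCommGroup P'] [Module R P']

/-- The map factors through `M ⊗ N'`; flatness of `M` serves the first factor and that of `N'` the
second. -/
theorem tensorMap_injective [Module.Flat R M] [Module.Flat R N'] {f : M →ₗ[R] N}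
    {g : M' →ₗ[R] N'} (hf : Function.Injective f) (hg : Function.Injective g) :
    Function.Injective (TensorProduct.map f g) := by
  rw [← LinearMap.rTensor_comp_lTensor]
  exact (Module.Flat.rTensor_preserves_injective_linearMap f hf).comp
    (Module.Flat.lTensor_preserves_injective_linearMap g hg)

/-- `ker (f ⊗ 1) ∩ ker (1 ⊗ f') = ker f ⊗ ker f'`. -/
theorem exists_ker_tensor_ker [Module.Flat R M'] [Module.Flat R P] [Module.Flat R P']
    {i : M →ₗ[R] N} {i' : M' →ₗ[R] N'} {f : M →ₗ[R] P} {f' : M' →ₗ[R] P'}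
    [Module.Flat R (LinearMap.ker f)]
    (hi : Function.Injective i) (hi' : Function.Injective i') {t : M ⊗[R] M'}
    (h : TensorProduct.map f i' t = 0) (h' : TensorProduct.map i f' t = 0) :
    ∃ s : LinearMap.ker f ⊗[R] LinearMap.ker f',
      TensorProduct.map (LinearMap.ker f).subtype (LinearMap.ker f').subtype s = t := by
  rw [← LinearMap.lTensor_comp_rTensor, LinearMap.comp_apply] at h
  -- The factor `i'` can be cancelled, so `f ⊗ 1` kills `t`, and flatness of `M'` puts `t` in `ker f
  -- ⊗ M'`.
  have h₁ := Module.Flat.lTensor_preserves_injective_linearMap (M := P) i' hi'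
    (h.trans (map_zero _).symm)
  obtain ⟨t₁, rfl⟩ := (Module.Flat.rTensor_exact (M := M')
    (LinearMap.exact_subtype_ker_map f) t).1 h₁
  -- The same argument in the second factor, now inside `ker f ⊗ M'`; this is where flatness of `ker
  -- f` enters.
  rw [← LinearMap.comp_apply, LinearMap.map_comp_rTensor, ← LinearMap.rTensor_comp_lTensor,
    LinearMap.comp_apply] at h'
  have h₂ := Module.Flat.rTensor_preserves_injective_linearMap (M := P')
    (i ∘ₗ (LinearMap.ker f).subtype) (hi.comp Subtype.val_injective) (h'.trans (map_zero _).symm)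
  obtain ⟨s, rfl⟩ := (Module.Flat.lTensor_exact (M := LinearMap.ker f)
    (LinearMap.exact_subtype_ker_map f') t₁).1 h₂
  refine ⟨s, ?_⟩
  rw [← LinearMap.rTensor_comp_lTensor]
  rfl

/-- In the application `e` is the sign in the Leibniz rule and `q`, `q'` are the projections away
from the allowed paths. Applying `q ⊗ 1` to the identity leaves only the term with `d`; applying `e
⊗ q'` leaves only the term with `d'` and undoes the sign. -/
theorem tensor_eq_zero_of_leibniz {i : M →ₗ[R] N} {i' : M' →ₗ[R] N'} {d e q : N →ₗ[R] N}
    {d' q' : N' →ₗ[R] N'} (h₁ : q ∘ₗ i = 0) (h₂ : q ∘ₗ e ∘ₗ i = 0) (h₃ : q' ∘ₗ i' = 0)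
    (h₄ : e ∘ₗ e ∘ₗ i = i) {s t : M ⊗[R] M'}
    (h : TensorProduct.map i i' s =
      TensorProduct.map (d ∘ₗ i) i' t + TensorProduct.map (e ∘ₗ i) (d' ∘ₗ i') t) :
    TensorProduct.map (q ∘ₗ d ∘ₗ i) i' t = 0 ∧ TensorProduct.map i (q' ∘ₗ d' ∘ₗ i') t = 0 := by
  constructor
  · have := congrArg (q.rTensor N') h
    rw [map_add] at this
    simp only [← LinearMap.comp_apply, LinearMap.rTensor_comp_map, h₁, h₂] at this
    simpa using this.symm
  · have := congrArg (TensorProduct.map e q') h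
    rw [map_add] at this
    simp only [← LinearMap.comp_apply, ← TensorProduct.map_comp, h₃, h₄] at this
    simpa using this.symm

/-- Over a PID flat means torsion-free, which passes to submodules. -/
instance flat_submodule [IsDomain R] [IsPrincipalIdealRing R] [Module.IsTorsionFree R M]
    (A : Submodule R M) : Module.Flat R A :=
  (IsDedekindDomain.flat_iff_torsion_eq_bot (R := R) (M := A)).2
    (Submodule.isTorsionFree_iff_torsion_eq_bot.1 inferInstance)

/-- If the Leibniz boundary of `t ∈ A ⊗ A'` lies in `A ⊗ A'`, then `t` is in the tensor product of
the submodules of elements whose boundary lies in `A` and in `A'`. -/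
theorem exists_tensor_ker_of_leibniz [IsDomain R] [IsPrincipalIdealRing R]
    [Module.IsTorsionFree R N] [Module.IsTorsionFree R N'] (A : Submodule R N)
    (A' : Submodule R N') {d e q : N →ₗ[R] N} {d' q' : N' →ₗ[R] N'}
    (h₁ : q ∘ₗ A.subtype = 0) (h₂ : q ∘ₗ e ∘ₗ A.subtype = 0) (h₃ : q' ∘ₗ A'.subtype = 0)
    (h₄ : e ∘ₗ e ∘ₗ A.subtype = A.subtype) {s t : A ⊗[R] A'}
    (h : TensorProduct.map A.subtype A'.subtype s =
      TensorProduct.map (d ∘ₗ A.subtype) A'.subtype t +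
        TensorProduct.map (e ∘ₗ A.subtype) (d' ∘ₗ A'.subtype) t) :
    ∃ u : LinearMap.ker (q ∘ₗ d ∘ₗ A.subtype) ⊗[R] LinearMap.ker (q' ∘ₗ d' ∘ₗ A'.subtype),
      TensorProduct.map (LinearMap.ker (q ∘ₗ d ∘ₗ A.subtype)).subtype
        (LinearMap.ker (q' ∘ₗ d' ∘ₗ A'.subtype)).subtype u = t := by
  have h' := tensor_eq_zero_of_leibniz h₁ h₂ h₃ h₄ h
  have : Module.Flat R N :=
    (IsDedekindDomain.flat_iff_torsion_eq_bot (R := R) (M := N)).2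
      (Submodule.isTorsionFree_iff_torsion_eq_bot.1 inferInstance)
  have : Module.Flat R N' :=
    (IsDedekindDomain.flat_iff_torsion_eq_bot (R := R) (M := N')).2
      (Submodule.isTorsionFree_iff_torsion_eq_bot.1 inferInstance)
  exact exists_ker_tensor_ker A.subtype_injective A'.subtype_injective h'.1 h'.2

end FlatTensor

/-! ### Projections onto spans of paths, and concatenation as a map on the tensor product. -/

namespace PathModule

variable {R : Type u} [CommRing R] {V V' : Type u}

open Classical in
/-- The projection onto the span of the paths in `s`. -/
def proj (R : Type u) [CommRing R] (s : Set (List V)) : PathModule R V →ₗ[R] PathModule R V :=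
  (Finsupp.supported R R s).subtype ∘ₗ Finsupp.restrictDom R R s

open Classical in
theorem proj_single (s : Set (List V)) (l : List V) (c : R) :
    proj R s (Finsupp.single l c) = if l ∈ s then Finsupp.single l c else 0 := by
  simp only [proj, LinearMap.comp_apply, Submodule.subtype_apply, Finsupp.restrictDom_apply]
  split_ifs with h
  · exact Finsupp.filter_single_of_pos _ h
  · exact Finsupp.filter_single_of_neg _ h

theorem proj_mem (s : Set (List V)) (x : PathModule R V) :
    proj R s x ∈ Finsupp.supported R R s := by
  classical exact (Finsupp.restrictDom R R s x).2

theorem proj_eq_self {s : Set (List V)} {x : PathModule R V} (hx : x ∈ Finsupp.supported R R s) :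
    proj R s x = x := by
  classical
  exact Finsupp.filter_eq_self_iff _ _ |>.2 fun l hl => hx (Finsupp.mem_support_iff.2 hl)

theorem proj_eq_zero_iff {s : Set (List V)} {x : PathModule R V} :
    proj R s x = 0 ↔ x ∈ Finsupp.supported R R sᶜ := by
  classical
  refine (Finsupp.filter_eq_zero_iff _ _).trans ⟨fun h l hl hs => ?_, fun h l hl => ?_⟩
  · exact Finsupp.mem_support_iff.1 hl (h l hs)
  · by_contra hne
    exact h (Finsupp.mem_support_iff.2 hne) hl

/-- The concatenation map on the tensor product. -/
def concatTensor (R V V' : Type u) [CommRing R] :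
    PathModule R V ⊗[R] PathModule R V' →ₗ[R] PathModule R (V ⊕ V') :=
  TensorProduct.lift (concat R V V')

/-- Filtering a concatenated word by summand recovers both words. -/
theorem map_inl_append_injective :
    Function.Injective fun p : List V × List V' =>
      (p.1.map Sum.inl ++ p.2.map Sum.inr : List (V ⊕ V')) := by
  rintro ⟨l, l'⟩ ⟨m, m'⟩ h
  have h₁ := congrArg (List.filterMap Sum.getLeft?) h
  have h₂ := congrArg (List.filterMap Sum.getRight?) h
  simp only [List.filterMap_append, List.filterMap_map] at h₁ h₂
  have e₁ : ((Sum.getLeft? : V ⊕ V' → Option V) ∘ Sum.inl) = some := rfl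
  have e₂ : ((Sum.getLeft? : V ⊕ V' → Option V) ∘ Sum.inr) = fun _ => none := rfl
  have e₃ : ((Sum.getRight? : V ⊕ V' → Option V') ∘ Sum.inl) = fun _ => none := rfl
  have e₄ : ((Sum.getRight? : V ⊕ V' → Option V') ∘ Sum.inr) = some := rfl
  simp [e₁, e₂, e₃, e₄] at h₁ h₂
  rw [h₁, h₂]

/-- Pairs of words form a basis of the tensor product, and concatenation maps this basis injectively
to words. -/
theorem concatTensor_injective : Function.Injective (concatTensor R V V') := by
  have : concatTensor R V V' = Finsupp.lmapDomain R R (fun p : List V × List V' =>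
      (p.1.map Sum.inl ++ p.2.map Sum.inr : List (V ⊕ V'))) ∘ₗ
        (finsuppTensorFinsupp' R (List V) (List V')).toLinearMap := by
    ext l l' : 5
    simp [concatTensor, concat, Finsupp.mapDomain_single, finsuppTensorFinsupp'_single_tmul_single]
  rw [this]
  exact (Finsupp.mapDomain_injective map_inl_append_injective).comp (LinearEquiv.injective _)

theorem proj_concat (n : ℕ) (x : PathModule R V) (y : PathModule R V') :
    proj R {l | l.length = n} (concat R V V' x y) =
      ∑ p ∈ Finset.HasAntidiagonal.antidiagonal n,
        concat R V V' (proj R {l | l.length = p.1} x) (proj R {l | l.length = p.2} y) := by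
  have : (concat R V V').compr₂ (proj R {l | l.length = n}) =
      ∑ p ∈ Finset.HasAntidiagonal.antidiagonal n, (concat R V V').compl₁₂ (proj R {l | l.length = p.1})
        (proj R {l | l.length = p.2}) := by
    ext1 l
    ext1
    ext1 l'
    ext1
    simp only [LinearMap.comp_apply, Finsupp.lsingle_apply, LinearMap.compr₂_apply,
      LinearMap.compl₁₂_apply, concat_single, LinearMap.sum_apply, proj_single]
    -- On basis words at most one pair of lengths contributes, namely that of `l` and `l'`.
    by_cases h : l.length + l'.length = n
    · rw [Finset.sum_eq_single_of_mem (l.length, l'.length) (by simpa using h)]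
      · simp [h, concat_single]
      · rintro ⟨a, b⟩ - hne
        by_cases ha : l.length = a
        · have hb : l'.length ≠ b := fun hb => hne (by rw [ha, hb])
          simp [hb]
        · simp [ha]
    · rw [Finset.sum_eq_zero]
      · simp [h]
      · rintro ⟨a, b⟩ hab
        rw [Finset.HasAntidiagonal.mem_antidiagonal] at hab
        by_cases ha : l.length = a
        · have hb : l'.length ≠ b := fun hb => h (by rw [ha, hb]; exact hab)
          simp [hb]
        · simp [ha]
  simpa using LinearMap.congr_fun₂ this x y

/-- The sign `(-1) ^ (number of vertices)`. -/
def sign (R V : Type u) [CommRing R] : PathModule R V →ₗ[R] PathModule R V :=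
  Finsupp.linearCombination R fun l : List V => (-1 : R) ^ l.length • Finsupp.single l (1 : R)

theorem sign_single (l : List V) :
    sign R V (Finsupp.single l 1) = (-1 : R) ^ l.length • Finsupp.single l 1 := by
  simp [sign]

theorem sign_sign : sign R V ∘ₗ sign R V = LinearMap.id := by
  ext1 l
  ext1
  simp only [LinearMap.comp_apply, Finsupp.lsingle_apply, sign_single, map_smul, smul_smul,
    ← mul_pow]
  simp

end PathModule

/-! ### The `∂`-invariant paths of a join are the tensor products of those of the factors. -/

namespace WeightedDigraph

open PathModule

variable {R : Type u} [CommRing R]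

theorem proj_length_eq_zero (G : WeightedDigraph R) {j k : ℕ} (h : j ≠ k)
    {x : PathModule R G.V} (hx : x ∈ G.ofLength j) : proj R {l | l.length = k} x = 0 :=
  proj_eq_zero_iff.2 fun _ hl e => h ((hx hl).symm.trans e)

theorem proj_allowed (G : WeightedDigraph R) (s : Set (List G.V)) {x : PathModule R G.V}
    (hx : x ∈ G.allowed) : proj R s x ∈ G.allowed := by
  rw [allowed, Finsupp.supported_eq_span_single] at hx
  induction hx using Submodule.span_induction with
  | mem x hx =>
    obtain ⟨l, hl, rfl⟩ := hx
    rw [proj_single]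
    split_ifs
    · exact Finsupp.single_mem_supported R _ hl
    · exact zero_mem _
  | zero => simp
  | add x y _ _ hx hy => rw [map_add]; exact add_mem hx hy
  | smul c x _ hx => rw [map_smul]; exact Submodule.smul_mem _ _ hx

theorem d_single_nil (G : WeightedDigraph R) (c : R) : G.d (Finsupp.single [] c) = 0 := by
  simp [d, regBoundary, boundary_nil]

theorem d_proj (G : WeightedDigraph R) (k : ℕ) (x : PathModule R G.V) :
    G.d (proj R {l | l.length = k + 1} x) = proj R {l | l.length = k} (G.d x) := by
  have : G.d ∘ₗ proj R {l | l.length = k + 1} = proj R {l | l.length = k} ∘ₗ G.d := by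
    ext1 l
    ext1
    simp only [LinearMap.comp_apply, Finsupp.lsingle_apply, proj_single]
    rcases hl : l.length with _ | n
    · rw [List.length_eq_zero_iff] at hl
      subst hl
      simp [d_single_nil]
    · have h₁ : G.d (Finsupp.single l 1) ∈ G.ofLength n :=
        G.d_ofLength (Finsupp.single_mem_supported R _ hl)
      by_cases h : n = k
      · subst h
        rw [proj_eq_self h₁]
        simp [hl]
      · rw [G.proj_length_eq_zero h h₁]
        simp [hl, h]
  exact LinearMap.congr_fun this x

theorem d_ofLength_zero (G : WeightedDigraph R) {x : PathModule R G.V} (hx : x ∈ G.ofLength 0) :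
    G.d x = 0 := by
  rw [ofLength, Finsupp.supported_eq_span_single] at hx
  induction hx using Submodule.span_induction with
  | mem x hx =>
    obtain ⟨l, hl, rfl⟩ := hx
    rw [List.length_eq_zero_iff.1 hl]
    exact G.d_single_nil 1
  | zero => simp
  | add x y _ _ hx hy => rw [map_add, hx, hy, add_zero]
  | smul c x _ hx => rw [map_smul, hx, smul_zero]

/-- The projection onto the span of the paths that are not allowed. -/
def projNotAllowed (G : WeightedDigraph R) : PathModule R G.V →ₗ[R] PathModule R G.V :=
  proj R {l : List G.V | l.IsChain G.graph.Adj}ᶜ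

theorem projNotAllowed_eq_zero_iff (G : WeightedDigraph R) {x : PathModule R G.V} :
    G.projNotAllowed x = 0 ↔ x ∈ G.allowed := by
  rw [projNotAllowed, proj_eq_zero_iff, compl_compl]
  rfl

/-- The obstruction for an allowed path to be `∂`-invariant. -/
abbrev obstruction (G : WeightedDigraph R) : G.allowed →ₗ[R] PathModule R G.V :=
  G.projNotAllowed ∘ₗ G.d ∘ₗ G.allowed.subtype

/-- The component with `k` vertices of a `∂`-invariant path. -/
def component (G : WeightedDigraph R) (k : ℕ) :
    LinearMap.ker G.obstruction →ₗ[R] G.Omega k :=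
  LinearMap.codRestrict _
    (proj R {l | l.length = k} ∘ₗ G.allowed.subtype ∘ₗ (LinearMap.ker G.obstruction).subtype) (by
      rintro ⟨⟨x, hx⟩, h⟩
      have hd : G.d x ∈ G.allowed := G.projNotAllowed_eq_zero_iff.1 h
      refine ⟨⟨proj_mem _ x, G.proj_allowed _ hx⟩, ?_⟩
      refine Submodule.mem_comap.2 ?_
      change G.d (proj R {l | l.length = k} x) ∈ G.allowed
      -- `d_proj` moves the projection past `d` only in positive length; on the empty path `d` is
      -- zero.
      rcases k with _ | k
      · rw [G.d_ofLength_zero (proj_mem _ _)]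
        exact zero_mem _
      · rw [d_proj]
        exact G.proj_allowed _ hd)

variable (G G' : WeightedDigraph R)

/-- No edge of the join goes from `V'` to `V`, so a path that has entered `V'` stays there. -/
theorem exists_of_isChain_join (l : List (G.V ⊕ G'.V)) (hl : l.IsChain (JoinAdj G G')) :
    ∃ (u : List G.V) (v : List G'.V), u.IsChain G.graph.Adj ∧ v.IsChain G'.graph.Adj ∧
      l = u.map Sum.inl ++ v.map Sum.inr := by
  have key : ∃ (u : List G.V) (v : List G'.V), l = u.map Sum.inl ++ v.map Sum.inr := by
    induction l with
    | nil => exact ⟨[], [], rfl⟩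
    | cons a l ih =>
      obtain ⟨u, v, rfl⟩ := ih hl.tail
      rcases a with i | j
      · exact ⟨i :: u, v, rfl⟩
      · cases u with
        | nil => exact ⟨[], j :: v, rfl⟩
        | cons i u =>
          simp only [List.map_cons, List.cons_append, List.isChain_cons_cons] at hl
          exact nomatch hl.1
  obtain ⟨u, v, rfl⟩ := key
  refine ⟨u, v, ?_, ?_, rfl⟩
  · refine ((List.isChain_map _).1 (List.isChain_append.1 hl).1).imp fun a b h => ?_
    cases h with
    | left h => exact h
  · refine ((List.isChain_map _).1 (List.isChain_append.1 hl).2.1).imp fun a b h => ?_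
    cases h with
    | right h => exact h

/-- Together with `concatTensor_injective` this lets allowed paths of the join be treated as
tensors. -/
theorem exists_tensor_of_allowed {z : PathModule R (G.V ⊕ G'.V)} (hz : z ∈ (G.join G').allowed) :
    ∃ t : G.allowed ⊗[R] G'.allowed,
      concatTensor R G.V G'.V
        (TensorProduct.map G.allowed.subtype G'.allowed.subtype t) = z := by
  rw [allowed, Finsupp.supported_eq_span_single] at hz
  induction hz using Submodule.span_induction with
  | mem z hz =>
    obtain ⟨l, hl, rfl⟩ := hz
    obtain ⟨u, v, hu, hv, rfl⟩ := exists_of_isChain_join G G' l hl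
    exact ⟨⟨Finsupp.single u 1, Finsupp.single_mem_supported R _ hu⟩ ⊗ₜ
      ⟨Finsupp.single v 1, Finsupp.single_mem_supported R _ hv⟩, concat_single u v⟩
  | zero => exact ⟨0, by simp⟩
  | add x y _ _ hx hy =>
    obtain ⟨t, rfl⟩ := hx
    obtain ⟨t', rfl⟩ := hy
    exact ⟨t + t', by simp⟩
  | smul c x _ hx =>
    obtain ⟨t, rfl⟩ := hx
    exact ⟨c • t, by simp⟩

/-- The left factor may mix lengths, so the sign of the product rule has to be the operator `sign`
instead of a scalar. -/
theorem d_concat_of_allowed {x : PathModule R G.V} {y : PathModule R G'.V} (hx : x ∈ G.allowed)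
    (hy : y ∈ G'.allowed) :
    (G.join G').d (concat R G.V G'.V x y) =
      concat R G.V G'.V (G.d x) y + concat R G.V G'.V (sign R G.V x) (G'.d y) := by
  rw [allowed, Finsupp.supported_eq_span_single] at hx
  induction hx using Submodule.span_induction with
  | mem x hx =>
    obtain ⟨l, hl, rfl⟩ := hx
    have h := congrArg (regularize R (G.V ⊕ G'.V))
      (boundary_concat G.weight G'.weight l.length (Finsupp.single l 1)
        (Finsupp.single_mem_supported R _ rfl) y)
    rw [map_add, map_smul, regularize_concat, regularize_concat,
      G.regularize_of_allowed (Finsupp.single_mem_supported R _ hl),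
      G'.regularize_of_allowed hy] at h
    rw [sign_single, map_smul, LinearMap.smul_apply]
    exact h
  | zero => simp
  | add x y _ _ hx hy =>
    simp only [map_add, LinearMap.add_apply, hx, hy]
    abel
  | smul c x _ hx => simp only [map_smul, LinearMap.smul_apply, hx, smul_add]

theorem sign_allowed {x : PathModule R G.V} (hx : x ∈ G.allowed) : sign R G.V x ∈ G.allowed := by
  rw [allowed, Finsupp.supported_eq_span_single] at hx
  induction hx using Submodule.span_induction with
  | mem x hx =>
    obtain ⟨l, hl, rfl⟩ := hx
    rw [sign_single]
    exact Submodule.smul_mem _ _ (Finsupp.single_mem_supported R _ hl)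
  | zero => simp
  | add x y _ _ hx hy => rw [map_add]; exact add_mem hx hy
  | smul c x _ hx => rw [map_smul]; exact Submodule.smul_mem _ _ hx

theorem d_concatTensor (t : G.allowed ⊗[R] G'.allowed) :
    (G.join G').d (concatTensor R G.V G'.V
        (TensorProduct.map G.allowed.subtype G'.allowed.subtype t)) =
      concatTensor R G.V G'.V
        (TensorProduct.map (G.d ∘ₗ G.allowed.subtype) G'.allowed.subtype t) +
      concatTensor R G.V G'.V
        (TensorProduct.map (sign R G.V ∘ₗ G.allowed.subtype) (G'.d ∘ₗ G'.allowed.subtype) t) := by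
  induction t using TensorProduct.induction_on with
  | zero => simp
  | tmul x y =>
    exact d_concat_of_allowed G G' x.2 y.2
  | add x y hx hy =>
    simp only [map_add] at hx hy ⊢
    rw [hx, hy]
    abel

/-- Concatenation of `∂`-invariant paths, as a linear map on the tensor product. -/
def omegaConcat (a b : ℕ) : G.Omega a ⊗[R] G'.Omega b →ₗ[R] PathModule R (G.V ⊕ G'.V) :=
  concatTensor R G.V G'.V ∘ₗ TensorProduct.map (G.Omega a).subtype (G'.Omega b).subtype

theorem omegaConcat_mem {a b n : ℕ} (h : a + b = n) (x : G.Omega a ⊗[R] G'.Omega b) :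
    omegaConcat G G' a b x ∈ (G.join G').Omega n := by
  induction x using TensorProduct.induction_on with
  | zero => simp
  | tmul x y => exact concat_Omega h x.2 y.2
  | add x y hx hy => rw [map_add]; exact add_mem hx hy

/-- The sum of the concatenations of the components of total degree `n`. -/
def totalConcat (n : ℕ) :
    (∀ i : ℕ × ℕ, G.Omega i.1 ⊗[R] G'.Omega i.2) →ₗ[R] PathModule R (G.V ⊕ G'.V) :=
  ∑ i ∈ Finset.HasAntidiagonal.antidiagonal n, omegaConcat G G' i.1 i.2 ∘ₗ LinearMap.proj i

theorem totalConcat_apply (n : ℕ) (x : ∀ i : ℕ × ℕ, G.Omega i.1 ⊗[R] G'.Omega i.2) :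
    totalConcat G G' n x = ∑ i ∈ Finset.HasAntidiagonal.antidiagonal n, omegaConcat G G' i.1 i.2 (x i) := by
  simp [totalConcat]

theorem totalConcat_mem (n : ℕ) (x : ∀ i : ℕ × ℕ, G.Omega i.1 ⊗[R] G'.Omega i.2) :
    totalConcat G G' n x ∈ (G.join G').Omega n := by
  rw [totalConcat_apply]
  exact Submodule.sum_mem _ fun i hi => omegaConcat_mem G G' (Finset.HasAntidiagonal.mem_antidiagonal.1 hi) _

section

variable [IsDomain R] [IsPrincipalIdealRing R]

theorem exists_ker_obstruction_of_leibniz {s t : G.allowed ⊗[R] G'.allowed}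
    (h : TensorProduct.map G.allowed.subtype G'.allowed.subtype s =
      TensorProduct.map (G.d ∘ₗ G.allowed.subtype) G'.allowed.subtype t +
        TensorProduct.map (sign R G.V ∘ₗ G.allowed.subtype) (G'.d ∘ₗ G'.allowed.subtype) t) :
    ∃ u : LinearMap.ker G.obstruction ⊗[R] LinearMap.ker G'.obstruction,
      TensorProduct.map (LinearMap.ker G.obstruction).subtype
        (LinearMap.ker G'.obstruction).subtype u = t := by
  have n₁ : G.projNotAllowed ∘ₗ G.allowed.subtype = 0 := by
    ext1 x
    exact G.projNotAllowed_eq_zero_iff.2 x.2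
  have n₂ : G.projNotAllowed ∘ₗ sign R G.V ∘ₗ G.allowed.subtype = 0 := by
    ext1 x
    exact G.projNotAllowed_eq_zero_iff.2 (G.sign_allowed x.2)
  have n₃ : G'.projNotAllowed ∘ₗ G'.allowed.subtype = 0 := by
    ext1 x
    exact G'.projNotAllowed_eq_zero_iff.2 x.2
  have n₄ : sign R G.V ∘ₗ sign R G.V ∘ₗ G.allowed.subtype = G.allowed.subtype := by
    rw [← LinearMap.comp_assoc, sign_sign, LinearMap.id_comp]
  have key := @exists_tensor_ker_of_leibniz R _ (PathModule R G.V) (PathModule R G'.V) _ _ _ _ _ _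
    _ _ G.allowed G'.allowed G.d (sign R G.V) G.projNotAllowed G'.d G'.projNotAllowed
    n₁ n₂ n₃ n₄ s t
  exact key h

/-- Both `z` and its boundary are allowed, hence both are tensors of allowed paths, and the Leibniz
rule relates them. -/
theorem exists_tensor_ker_obstruction {n : ℕ} {z : PathModule R (G.V ⊕ G'.V)}
    (hz : z ∈ (G.join G').Omega n) :
    ∃ s : LinearMap.ker G.obstruction ⊗[R] LinearMap.ker G'.obstruction,
      concatTensor R G.V G'.V
        (TensorProduct.map G.allowed.subtype G'.allowed.subtype
          (TensorProduct.map (LinearMap.ker G.obstruction).subtype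
            (LinearMap.ker G'.obstruction).subtype s)) = z := by
  have hd : (G.join G').d z ∈ (G.join G').allowed := Submodule.mem_comap.1 hz.2
  obtain ⟨t, ht⟩ := exists_tensor_of_allowed G G' hz.1.2
  obtain ⟨s, hs⟩ := exists_tensor_of_allowed G G' hd
  rw [← ht, d_concatTensor] at hs
  have hs' : TensorProduct.map G.allowed.subtype G'.allowed.subtype s =
      TensorProduct.map (G.d ∘ₗ G.allowed.subtype) G'.allowed.subtype t +
        TensorProduct.map (sign R G.V ∘ₗ G.allowed.subtype) (G'.d ∘ₗ G'.allowed.subtype) t := by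
    -- Injectivity of concatenation turns the identity of paths in the join into one of tensors, to
    -- which the flatness argument applies.
    apply concatTensor_injective (R := R) (V := G.V) (V' := G'.V)
    rw [map_add]
    exact hs
  exact (exists_ker_obstruction_of_leibniz G G' hs').imp fun u hu => by rw [hu, ht]

theorem proj_concatTensor (n : ℕ)
    (s : LinearMap.ker G.obstruction ⊗[R] LinearMap.ker G'.obstruction) :
    proj R {l | l.length = n} (concatTensor R G.V G'.V
        (TensorProduct.map G.allowed.subtype G'.allowed.subtype
          (TensorProduct.map (LinearMap.ker G.obstruction).subtype
            (LinearMap.ker G'.obstruction).subtype s))) =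
      totalConcat G G' n fun i => TensorProduct.map (G.component i.1) (G'.component i.2) s := by
  rw [totalConcat_apply]
  induction s using TensorProduct.induction_on with
  | zero => simp
  | tmul x y => exact proj_concat n x.1.1 y.1.1
  | add x y hx hy =>
    simp only [map_add, Finset.sum_add_distrib]
    rw [hx, hy]

/-- The tensor obtained from `exists_tensor_ker_obstruction` is not homogeneous. Since `z` is,
projecting to length `n` changes nothing and distributes the tensor over the bidegrees. -/
theorem exists_totalConcat {n : ℕ} {z : PathModule R (G.V ⊕ G'.V)}
    (hz : z ∈ (G.join G').Omega n) :
    ∃ x : ∀ i : ℕ × ℕ, G.Omega i.1 ⊗[R] G'.Omega i.2, totalConcat G G' n x = z := by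
  obtain ⟨s, hs⟩ := exists_tensor_ker_obstruction G G' hz
  refine ⟨_, (proj_concatTensor G G' n s).symm.trans ?_⟩
  rw [hs]
  exact proj_eq_self hz.1.1

/-- Families are indexed by all of `ℕ × ℕ`, but only the entries of total degree `n` enter the sum,
so only these can be shown to vanish. The length `a` of the left factor already singles out one of
them, and `Ω ⊗ Ω'` embeds in the tensor product of the path modules by flatness. -/
theorem totalConcat_eq_zero {n : ℕ} {x : ∀ i : ℕ × ℕ, G.Omega i.1 ⊗[R] G'.Omega i.2}
    (hx : totalConcat G G' n x = 0) {a b : ℕ} (h : a + b = n) : x (a, b) = 0 := by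
  have h₁ : ∑ i ∈ Finset.HasAntidiagonal.antidiagonal n,
      TensorProduct.map (G.Omega i.1).subtype (G'.Omega i.2).subtype (x i) = 0 := by
    apply concatTensor_injective (R := R) (V := G.V) (V' := G'.V)
    rw [map_sum, map_zero, ← hx, totalConcat_apply]
    rfl
  have h₂ := congrArg ((proj R {l : List G.V | l.length = a}).rTensor (PathModule R G'.V)) h₁
  rw [map_sum, map_zero, Finset.sum_eq_single_of_mem (a, b) (by simpa using h)] at h₂
  · rw [← LinearMap.comp_apply, LinearMap.rTensor_comp_map] at h₂
    have : proj R {l : List G.V | l.length = a} ∘ₗ (G.Omega a).subtype = (G.Omega a).subtype := by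
      ext1 y
      exact proj_eq_self y.2.1.1
    rw [this] at h₂
    exact tensorMap_injective (M := G.Omega a) (N' := PathModule R G'.V)
      (Submodule.subtype_injective _) (Submodule.subtype_injective _) (h₂.trans (map_zero _).symm)
  · rintro ⟨a', b'⟩ hab hne
    have ha : a' ≠ a := by
      rintro rfl
      rw [Finset.HasAntidiagonal.mem_antidiagonal] at hab
      exact hne (by simp only [Prod.mk.injEq, true_and]; simp only at hab; omega)
    rw [← LinearMap.comp_apply, LinearMap.rTensor_comp_map]
    have : proj R {l : List G.V | l.length = a} ∘ₗ (G.Omega a').subtype = 0 := by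
      ext1 y
      exact G.proj_length_eq_zero ha y.2.1.1
    simp [this]

end

end WeightedDigraph

/-! ### The algebraic Künneth formula on the level of chains. -/

/-- The cycles, boundaries, homology and cokernels of a complex `C` of modules, up to
isomorphism: `B k ≤ Z k ≤ C k`, `H k = Z k / B k` and `Q k = C k / B k`. -/
structure HomologyDatum (R : Type u) [CommRing R] (C Z B H Q : ℕ → Type u)
    [∀ k, AddCommGroup (C k)] [∀ k, Module R (C k)] [∀ k, AddCommGroup (Z k)]
    [∀ k, Module R (Z k)] [∀ k, AddCommGroup (B k)] [∀ k, Module R (B k)]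
    [∀ k, AddCommGroup (H k)] [∀ k, Module R (H k)] [∀ k, AddCommGroup (Q k)]
    [∀ k, Module R (Q k)] where
  iZ : ∀ k, Z k →ₗ[R] C k
  iB : ∀ k, B k →ₗ[R] Z k
  δ : ∀ k, C (k + 1) →ₗ[R] B k
  π : ∀ k, Z k →ₗ[R] H k
  κ : ∀ k, C k →ₗ[R] Q k
  j : ∀ k, H k →ₗ[R] Q k
  dQ : ∀ k, Q (k + 1) →ₗ[R] B k
  iZ_injective : ∀ k, Function.Injective (iZ k)
  iB_injective : ∀ k, Function.Injective (iB k)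
  j_injective : ∀ k, Function.Injective (j k)
  δ_surjective : ∀ k, Function.Surjective (δ k)
  π_surjective : ∀ k, Function.Surjective (π k)
  κ_surjective : ∀ k, Function.Surjective (κ k)
  -- The complex ends at index 0 (degree `-1`), where everything is a cycle.
  iZ_zero_surjective : Function.Surjective (iZ 0)
  exact_iB_π : ∀ k, Function.Exact (iB k) (π k)
  exact_iZ_δ : ∀ k, Function.Exact (iZ (k + 1)) (δ k)
  exact_κ : ∀ k, Function.Exact (iZ k ∘ₗ iB k) (κ k)
  exact_j_dQ : ∀ k, Function.Exact (j (k + 1)) (dQ k)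
  j_π : ∀ k, j k ∘ₗ π k = κ k ∘ₗ iZ k

theorem TensorProduct.map_map_apply {R : Type u} [CommRing R] {M N P M' N' P' : Type u}
    [AddCommGroup M] [Module R M] [AddCommGroup N] [Module R N] [AddCommGroup P] [Module R P]
    [AddCommGroup M'] [Module R M'] [AddCommGroup N'] [Module R N'] [AddCommGroup P'] [Module R P']
    (g : N →ₗ[R] P) (g' : N' →ₗ[R] P') (f : M →ₗ[R] N) (f' : M' →ₗ[R] N') (t : M ⊗[R] M') :
    TensorProduct.map g g' (TensorProduct.map f f' t) =
      TensorProduct.map (g ∘ₗ f) (g' ∘ₗ f') t := by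
  rw [TensorProduct.map_comp]; rfl

namespace HomologyDatum

variable {R : Type u} [CommRing R] {C Z B H Q C' Z' B' H' Q' : ℕ → Type u}
    [∀ k, AddCommGroup (C k)] [∀ k, Module R (C k)] [∀ k, AddCommGroup (Z k)]
    [∀ k, Module R (Z k)] [∀ k, AddCommGroup (B k)] [∀ k, Module R (B k)]
    [∀ k, AddCommGroup (H k)] [∀ k, Module R (H k)] [∀ k, AddCommGroup (Q k)]
    [∀ k, Module R (Q k)]
    [∀ k, AddCommGroup (C' k)] [∀ k, Module R (C' k)] [∀ k, AddCommGroup (Z' k)]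
    [∀ k, Module R (Z' k)] [∀ k, AddCommGroup (B' k)] [∀ k, Module R (B' k)]
    [∀ k, AddCommGroup (H' k)] [∀ k, Module R (H' k)] [∀ k, AddCommGroup (Q' k)]
    [∀ k, Module R (Q' k)]

/-- The differential `C (k + 1) → C k`. -/
def d (X : HomologyDatum R C Z B H Q) (k : ℕ) : C (k + 1) →ₗ[R] C k :=
  X.iZ k ∘ₗ X.iB k ∘ₗ X.δ k

theorem δ_iZ (X : HomologyDatum R C Z B H Q) (k : ℕ) : X.δ k ∘ₗ X.iZ (k + 1) = 0 := by
  ext x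
  exact (X.exact_iZ_δ k).apply_apply_eq_zero x

theorem π_iB (X : HomologyDatum R C Z B H Q) (k : ℕ) : X.π k ∘ₗ X.iB k = 0 := by
  ext x
  exact (X.exact_iB_π k).apply_apply_eq_zero x

theorem d_iZ (X : HomologyDatum R C Z B H Q) (k : ℕ) : X.d k ∘ₗ X.iZ (k + 1) = 0 := by
  rw [d, LinearMap.comp_assoc, LinearMap.comp_assoc, δ_iZ, LinearMap.comp_zero, LinearMap.comp_zero]

theorem κ_d (X : HomologyDatum R C Z B H Q) (k : ℕ) : X.κ k ∘ₗ X.d k = 0 := by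
  ext x
  exact (X.exact_κ k).apply_apply_eq_zero (X.δ k x)

theorem δ_d (X : HomologyDatum R C Z B H Q) (k : ℕ) : X.δ k ∘ₗ X.d (k + 1) = 0 := by
  rw [d, ← LinearMap.comp_assoc, δ_iZ, LinearMap.zero_comp]

theorem d_d (X : HomologyDatum R C Z B H Q) (k : ℕ) : X.d k ∘ₗ X.d (k + 1) = 0 := by
  rw [d, LinearMap.comp_assoc, LinearMap.comp_assoc, δ_d, LinearMap.comp_zero, LinearMap.comp_zero]

variable (X : HomologyDatum R C Z B H Q) (X' : HomologyDatum R C' Z' B' H' Q')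

/-- The differential of the tensor product complex. -/
def totalD (x : ∀ i : ℕ × ℕ, C i.1 ⊗[R] C' i.2) (i : ℕ × ℕ) : C i.1 ⊗[R] C' i.2 :=
  TensorProduct.map (X.d i.1) LinearMap.id (x (i.1 + 1, i.2)) +
    (-1 : R) ^ i.1 • TensorProduct.map LinearMap.id (X'.d i.2) (x (i.1, i.2 + 1))

theorem totalD_totalD (x : ∀ i : ℕ × ℕ, C i.1 ⊗[R] C' i.2) (i : ℕ × ℕ) :
    totalD X X' (totalD X X' x) i = 0 := by
  simp only [totalD, map_add, map_smul, TensorProduct.map_map_apply, d_d, LinearMap.id_comp,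
    LinearMap.comp_id, TensorProduct.map_zero_left, TensorProduct.map_zero_right, pow_succ]
  simp

theorem totalD_sub (x y : ∀ i : ℕ × ℕ, C i.1 ⊗[R] C' i.2) (i : ℕ × ℕ) :
    totalD X X' (x - y) i = totalD X X' x i - totalD X X' y i := by
  simp only [totalD, Pi.sub_apply, map_sub, smul_sub]
  abel

/-- The obstruction for the component of `x` in bidegree `i` to come from a product of cycles. -/
def torPart (i : ℕ × ℕ) (x : ∀ i : ℕ × ℕ, C i.1 ⊗[R] C' i.2) : Q i.1 ⊗[R] B' i.2 :=
  TensorProduct.map (X.κ i.1) (X'.δ i.2) (x (i.1, i.2 + 1))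

/-- One summand of the differential dies by `κ d = 0`, the other by `δ d = 0`. Hence `torPart`
descends to homology. -/
theorem torPart_totalD (x : ∀ i : ℕ × ℕ, C i.1 ⊗[R] C' i.2) (i : ℕ × ℕ) :
    torPart X X' i (totalD X X' x) = 0 := by
  simp only [torPart, totalD, map_add, map_smul, TensorProduct.map_map_apply, κ_d, δ_d,
    TensorProduct.map_zero_left, TensorProduct.map_zero_right]
  simp

theorem comp_d_eq_zero {k : ℕ} {r : C k →ₗ[R] H k} (hr : r ∘ₗ X.iZ k = X.π k) :
    r ∘ₗ X.d k = 0 := by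
  rw [d, ← LinearMap.comp_assoc, hr, ← LinearMap.comp_assoc, π_iB, LinearMap.zero_comp]

/-- An extension of `Z → H` to `C` still kills boundaries, so `r ⊗ r'` descends to homology. This is
the source of the splitting. -/
theorem map_totalD_eq_zero {i : ℕ × ℕ} {r : C i.1 →ₗ[R] H i.1} {r' : C' i.2 →ₗ[R] H' i.2}
    (hr : r ∘ₗ X.iZ i.1 = X.π i.1) (hr' : r' ∘ₗ X'.iZ i.2 = X'.π i.2)
    (x : ∀ i : ℕ × ℕ, C i.1 ⊗[R] C' i.2) :
    TensorProduct.map r r' (totalD X X' x i) = 0 := by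
  simp only [totalD, map_add, map_smul, TensorProduct.map_map_apply, X.comp_d_eq_zero hr,
    X'.comp_d_eq_zero hr', TensorProduct.map_zero_left, TensorProduct.map_zero_right]
  simp

/-- The products of cycles. -/
def cyclesFamily (z : ∀ i : ℕ × ℕ, Z i.1 ⊗[R] Z' i.2) (i : ℕ × ℕ) : C i.1 ⊗[R] C' i.2 :=
  TensorProduct.map (X.iZ i.1) (X'.iZ i.2) (z i)

theorem torPart_cyclesFamily (i : ℕ × ℕ) (z : ∀ i : ℕ × ℕ, Z i.1 ⊗[R] Z' i.2) :
    torPart X X' i (cyclesFamily X X' z) = 0 := by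
  simp only [torPart, cyclesFamily, TensorProduct.map_map_apply, δ_iZ,
    TensorProduct.map_zero_right, LinearMap.zero_apply]

theorem map_cyclesFamily {i : ℕ × ℕ} {r : C i.1 →ₗ[R] H i.1} {r' : C' i.2 →ₗ[R] H' i.2}
    (hr : r ∘ₗ X.iZ i.1 = X.π i.1) (hr' : r' ∘ₗ X'.iZ i.2 = X'.π i.2)
    (z : ∀ i : ℕ × ℕ, Z i.1 ⊗[R] Z' i.2) :
    TensorProduct.map r r' (cyclesFamily X X' z i) =
      TensorProduct.map (X.π i.1) (X'.π i.2) (z i) := by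
  rw [cyclesFamily, TensorProduct.map_map_apply, hr, hr']

section Projective

variable [∀ k, Module.Projective R (B k)]

/-- A section `s` of `δ` exists because `B` is projective, and `1 - s δ` projects onto the cycles.
-/
theorem exists_retraction (k : ℕ) : ∃ r : C k →ₗ[R] Z k, r ∘ₗ X.iZ k = LinearMap.id := by
  rcases k with _ | k
  · let e := LinearEquiv.ofBijective (X.iZ 0) ⟨X.iZ_injective 0, X.iZ_zero_surjective⟩
    exact ⟨e.symm, LinearMap.ext fun x => e.symm_apply_apply x⟩
  · obtain ⟨s, hs⟩ := Module.projective_lifting_property (X.δ k) LinearMap.id (X.δ_surjective k)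
    let p : C (k + 1) →ₗ[R] C (k + 1) := LinearMap.id - s ∘ₗ X.δ k
    have hp : ∀ x, p x ∈ LinearMap.range (X.iZ (k + 1)) := by
      intro x
      refine (X.exact_iZ_δ k _).1 ?_
      have := LinearMap.congr_fun hs (X.δ k x)
      simp only [LinearMap.comp_apply, LinearMap.id_apply] at this
      simp [p, this]
    let e := LinearEquiv.ofInjective (X.iZ (k + 1)) (X.iZ_injective _)
    refine ⟨e.symm.toLinearMap ∘ₗ p.codRestrict _ hp, LinearMap.ext fun z => ?_⟩
    have hz : X.δ k (X.iZ (k + 1) z) = 0 := (X.exact_iZ_δ k).apply_apply_eq_zero z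
    simp only [LinearMap.comp_apply, LinearEquiv.coe_coe, LinearMap.id_apply]
    rw [LinearEquiv.symm_apply_eq]
    ext
    simp [p, e, hz]

theorem exists_toHomology (k : ℕ) : ∃ r : C k →ₗ[R] H k, r ∘ₗ X.iZ k = X.π k := by
  obtain ⟨r, hr⟩ := X.exists_retraction k
  exact ⟨X.π k ∘ₗ r, by rw [LinearMap.comp_assoc, hr, LinearMap.comp_id]⟩

end Projective

variable [∀ k, Module.Projective R (C k)] [∀ k, Module.Projective R (Z k)]
  [∀ k, Module.Projective R (B k)] [∀ k, Module.Projective R (C' k)]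
  [∀ k, Module.Projective R (Z' k)] [∀ k, Module.Projective R (B' k)]

theorem isShortResolution (k : ℕ) :
    IsShortResolution (ModuleCat.ofHom (X'.iB k)) (ModuleCat.ofHom (X'.π k)) :=
  isShortResolution_ofHom (X'.iB_injective k) (X'.π_surjective k) (X'.exact_iB_π k)

open WeightedDigraph in
/-- The embedding of `Tor₁(H a, H' b)` into `Q a ⊗ B' b`. -/
def torInto (i : ℕ × ℕ) : TorOne R (H i.1) (H' i.2) →ₗ[R] Q i.1 ⊗[R] B' i.2 :=
  TensorProduct.map (X.j i.1) LinearMap.id ∘ₗ torEmb (H i.1) (X'.isShortResolution i.2)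

/-- The step from `H ⊗ B'` to `Q ⊗ B'` is injective because `B'` is flat. The larger target is
needed because the left factors in a component of a cycle need not be cycles and only have classes
in `Q`. -/
theorem torInto_injective (i : ℕ × ℕ) : Function.Injective (torInto X X' i) :=
  (Module.Flat.rTensor_preserves_injective_linearMap (M := B' i.2) (X.j i.1)
    (X.j_injective i.1)).comp (torEmb_injective _)

theorem exists_torInto {i : ℕ × ℕ} {t : Q i.1 ⊗[R] B' i.2}
    (ht : TensorProduct.map LinearMap.id (X'.iZ i.2 ∘ₗ X'.iB i.2) t = 0) :
    ∃ τ, torInto X X' i τ = t := by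
  obtain ⟨a, b⟩ := i
  obtain ⟨h, rfl⟩ : ∃ h : H a ⊗[R] B' b, TensorProduct.map (X.j a) LinearMap.id h = t := by
    -- First, `t` lies in `H ⊗ B'`. At index 0 this holds because `j` is onto; otherwise `dQ ⊗ 1`
    -- must kill `t`, which may be checked in `B ⊗ C'` as `B` is flat.
    rcases a with _ | a
    · refine TensorProduct.map_surjective (fun q => ?_) Function.surjective_id t
      obtain ⟨x, rfl⟩ := X.κ_surjective 0 q
      obtain ⟨z, rfl⟩ := X.iZ_zero_surjective x
      exact ⟨X.π 0 z, LinearMap.congr_fun (X.j_π 0) z⟩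
    · refine (Module.Flat.rTensor_exact (M := B' b) (X.exact_j_dQ a) t).1 ?_
      refine Module.Flat.lTensor_preserves_injective_linearMap (M := B a)
        (X'.iZ b ∘ₗ X'.iB b) ((X'.iZ_injective b).comp (X'.iB_injective b)) ?_
      rw [map_zero]
      refine (TensorProduct.map_map_apply _ _ _ _ t).trans ?_
      have := congrArg (TensorProduct.map (X.dQ a) LinearMap.id) ht
      rw [TensorProduct.map_map_apply, map_zero] at this
      exact this
  -- `H` need not be flat, so vanishing in `H ⊗ C'` is brought back to `H ⊗ Z'` by a retraction of
  -- `C'` onto `Z'`. The kernel of `H ⊗ B' → H ⊗ Z'` is `Tor`.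
  obtain ⟨r, hr⟩ := X'.exists_retraction b
  have h₁ : TensorProduct.map LinearMap.id (X'.iZ b ∘ₗ X'.iB b) h = 0 := by
    refine Module.Flat.rTensor_preserves_injective_linearMap (M := C' b) (X.j a)
      (X.j_injective a) ?_
    rw [map_zero]
    refine (TensorProduct.map_map_apply _ _ _ _ h).trans ?_
    rw [TensorProduct.map_map_apply] at ht
    exact ht
  have h₂ := congrArg (TensorProduct.map LinearMap.id r) h₁
  rw [TensorProduct.map_map_apply, map_zero, ← LinearMap.comp_assoc, hr] at h₂
  obtain ⟨τ, rfl⟩ := (torEmb_exact (M := H a) (X'.isShortResolution b) h).1 h₂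
  exact ⟨τ, rfl⟩

/-- Applying `κ ⊗ 1` to the cycle equation removes the term with the left differential; what is left
says, up to sign, that `torPart` dies in `Q ⊗ C'`. -/
theorem exists_torInto_eq_torPart {x : ∀ i : ℕ × ℕ, C i.1 ⊗[R] C' i.2} {i : ℕ × ℕ}
    (hx : totalD X X' x i = 0) : ∃ τ, torInto X X' i τ = torPart X X' i x := by
  refine exists_torInto X X' ?_
  have := congrArg (TensorProduct.map (X.κ i.1) LinearMap.id) hx
  simp only [totalD, map_add, map_smul, TensorProduct.map_map_apply, κ_d, map_zero,
    TensorProduct.map_zero_left, LinearMap.zero_apply, zero_add] at this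
  have h := congrArg ((-1 : R) ^ i.1 • ·) this
  simp only [smul_smul, ← mul_pow, neg_mul_neg, one_mul, one_pow, one_smul, smul_zero] at h
  rw [torPart, TensorProduct.map_map_apply]
  exact h

/-- Lift `τ ∈ H ⊗ B'` to `s`. As `τ` dies in `H ⊗ Z'`, the right boundary of `s` comes from `B ⊗
Z'`, hence is the left boundary of some `u`. These are the two components of a cycle representing
`τ`. -/
theorem exists_lift_torInto {i : ℕ × ℕ} (τ : WeightedDigraph.TorOne R (H i.1) (H' i.2)) :
    ∃ (s : Z i.1 ⊗[R] C' (i.2 + 1)) (u : C (i.1 + 1) ⊗[R] Z' i.2),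
      TensorProduct.map (X.κ i.1 ∘ₗ X.iZ i.1) (X'.δ i.2) s = torInto X X' i τ ∧
      TensorProduct.map (X.d i.1) LinearMap.id u =
        TensorProduct.map (X.iZ i.1) (X'.iB i.2 ∘ₗ X'.δ i.2) s := by
  obtain ⟨a, b⟩ := i
  have hτ : TensorProduct.map LinearMap.id (X'.iB b) (torEmb (H a) (X'.isShortResolution b) τ) = 0 :=
    (torEmb_exact (M := H a) (X'.isShortResolution b)).apply_apply_eq_zero τ
  obtain ⟨s, hs⟩ := TensorProduct.map_surjective (X.π_surjective a) (X'.δ_surjective b)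
    (torEmb (H a) (X'.isShortResolution b) τ)
  rw [← hs, TensorProduct.map_map_apply] at hτ
  have h₁ : (X.π a).rTensor (Z' b)
      (TensorProduct.map LinearMap.id (X'.iB b ∘ₗ X'.δ b) s) = 0 :=
    (TensorProduct.map_map_apply _ _ _ _ s).trans hτ
  obtain ⟨v, hv⟩ := (rTensor_exact (Z' b) (X.exact_iB_π a) (X.π_surjective a) _).1 h₁
  obtain ⟨u, rfl⟩ := LinearMap.rTensor_surjective (Z' b) (X.δ_surjective a) v
  refine ⟨s, u, ?_, ?_⟩
  · rw [torInto, LinearMap.comp_apply, ← hs, TensorProduct.map_map_apply, X.j_π]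
    rfl
  · have h₂ := congrArg (TensorProduct.map (X.iZ a) LinearMap.id) hv
    rw [TensorProduct.map_map_apply] at h₂
    refine Eq.trans ?_ h₂
    refine Eq.symm ?_
    rw [LinearMap.rTensor, LinearMap.rTensor, TensorProduct.map_map_apply,
      TensorProduct.map_map_apply]
    rfl

/-- Every family of elements of `Tor` is realized by a cycle. -/
theorem exists_cycle_torPart (τ : ∀ i : ℕ × ℕ, WeightedDigraph.TorOne R (H i.1) (H' i.2)) :
    ∃ x : ∀ i : ℕ × ℕ, C i.1 ⊗[R] C' i.2, (∀ i, totalD X X' x i = 0) ∧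
      ∀ i, torPart X X' i x = torInto X X' i (τ i) := by
  choose s u hs hu using fun i => exists_lift_torInto X X' (τ i)
  -- The component `s (a, b)` has bidegree `(a, b + 1)` and `u (a, b)` has bidegree `(a + 1, b)`;
  -- the entries not reached are 0.
  let x₁ : ∀ i : ℕ × ℕ, C i.1 ⊗[R] C' i.2 := fun
    | (_, 0) => 0
    | (a, b + 1) => TensorProduct.map (X.iZ a) LinearMap.id (s (a, b))
  let x₂ : ∀ i : ℕ × ℕ, C i.1 ⊗[R] C' i.2 := fun
    | (0, _) => 0
    | (a + 1, b) => TensorProduct.map LinearMap.id (X'.iZ b) (u (a, b))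
  have h₁ : ∀ a b, TensorProduct.map (X.d a) LinearMap.id (x₁ (a + 1, b)) = 0 := by
    rintro a (_ | b)
    · exact map_zero _
    · refine (TensorProduct.map_map_apply _ _ _ _ _).trans ?_
      rw [d_iZ, TensorProduct.map_zero_left]
      rfl
  have h₂ : ∀ a b, TensorProduct.map LinearMap.id (X'.d b) (x₂ (a, b + 1)) = 0 := by
    rintro (_ | a) b
    · exact map_zero _
    · refine (TensorProduct.map_map_apply _ _ _ _ _).trans ?_
      rw [d_iZ, TensorProduct.map_zero_right]
      rfl
  have h₃ : ∀ a b, TensorProduct.map (X.κ a) (X'.δ b) (x₂ (a, b + 1)) = 0 := by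
    rintro (_ | a) b
    · exact map_zero _
    · refine (TensorProduct.map_map_apply _ _ _ _ _).trans ?_
      rw [δ_iZ, TensorProduct.map_zero_right]
      rfl
  have h₄ : ∀ a b, TensorProduct.map (X.d a) LinearMap.id (x₂ (a + 1, b)) =
      TensorProduct.map LinearMap.id (X'.d b) (x₁ (a, b + 1)) := by
    intro a b
    have := congrArg (TensorProduct.map LinearMap.id (X'.iZ b)) (hu (a, b))
    simp only [TensorProduct.map_map_apply] at this
    simp only [x₁, x₂, TensorProduct.map_map_apply]
    exact this
  -- The sign makes the two equal terms of `h₄` cancel: `x₂` enters at index `a + 1`, while the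
  -- right differential carries the sign of `a`.
  refine ⟨fun i => x₁ i + (-1 : R) ^ i.1 • x₂ i, fun i => ?_, fun i => ?_⟩
  · obtain ⟨a, b⟩ := i
    simp only [totalD, map_add, map_smul, h₁, h₂, h₄, pow_succ]
    simp
  · obtain ⟨a, b⟩ := i
    simp only [torPart, map_add, map_smul, h₃]
    simp only [x₁, TensorProduct.map_map_apply]
    have := hs (a, b)
    simpa using this

/-- A cycle without `Tor` part is homologous to a sum of products of cycles. -/
theorem exists_cycle_tensor {n : ℕ} {x : ∀ i : ℕ × ℕ, C i.1 ⊗[R] C' i.2}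
    (hx : ∀ i : ℕ × ℕ, i.1 + i.2 = n → totalD X X' x i = 0)
    (ht : ∀ i : ℕ × ℕ, i.1 + i.2 = n → torPart X X' i x = 0) :
    ∃ (y : ∀ i : ℕ × ℕ, C i.1 ⊗[R] C' i.2) (z : ∀ i : ℕ × ℕ, Z i.1 ⊗[R] Z' i.2),
      ∀ i : ℕ × ℕ, i.1 + i.2 = n + 1 →
        x i = totalD X X' y i + TensorProduct.map (X.iZ i.1) (X'.iZ i.2) (z i) := by
  -- The kernel of `κ ⊗ δ`, a tensor product of surjections, is the sum of the images of `B ⊗ C'`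
  -- and `C ⊗ Z'`.
  have h₁ : ∀ i : ℕ × ℕ, ∃ (v : C (i.1 + 1) ⊗[R] C' (i.2 + 1)) (w : C i.1 ⊗[R] Z' (i.2 + 1)),
      i.1 + i.2 = n → TensorProduct.map (X.d i.1) LinearMap.id v +
        TensorProduct.map LinearMap.id (X'.iZ (i.2 + 1)) w = x (i.1, i.2 + 1) := by
    intro i
    by_cases hi : i.1 + i.2 = n
    · have hk : x (i.1, i.2 + 1) ∈ LinearMap.ker (TensorProduct.map (X.κ i.1) (X'.δ i.2)) :=
        ht i hi
      rw [TensorProduct.map_ker (X.exact_κ i.1) (X.κ_surjective i.1) (X'.exact_iZ_δ i.2)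
        (X'.δ_surjective i.2), Submodule.mem_sup] at hk
      obtain ⟨_, ⟨w, rfl⟩, _, ⟨v, rfl⟩, hvw⟩ := hk
      obtain ⟨v, rfl⟩ := LinearMap.rTensor_surjective (C' (i.2 + 1)) (X.δ_surjective i.1) v
      refine ⟨v, w, fun _ => ?_⟩
      refine (add_comm _ _).trans (Eq.trans ?_ hvw)
      simp only [LinearMap.rTensor, LinearMap.lTensor, TensorProduct.map_map_apply]
      rfl
    · exact ⟨0, 0, fun h => absurd h hi⟩
  choose v w hvw using h₁
  -- The left boundary of `y` removes the `v` part of `x`; its right boundary only adds elements of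
  -- `C ⊗ B'`.
  let y : ∀ i : ℕ × ℕ, C i.1 ⊗[R] C' i.2 := fun
    | (_, 0) => 0
    | (0, _) => 0
    | (a + 1, b + 1) => v (a, b)
  have h₂ : ∀ i : ℕ × ℕ, i.1 + i.2 = n + 1 → ∃ t : C i.1 ⊗[R] Z' i.2,
      TensorProduct.map LinearMap.id (X'.iZ i.2) t = (x - totalD X X' y) i := by
    rintro ⟨a, _ | b⟩ hi
    · exact TensorProduct.map_surjective Function.surjective_id X'.iZ_zero_surjective _
    · refine ⟨w (a, b) - (-1 : R) ^ a • TensorProduct.map LinearMap.id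
        (X'.iB (b + 1) ∘ₗ X'.δ (b + 1)) (y (a, b + 2)), ?_⟩
      rw [Pi.sub_apply, ← hvw (a, b) (by simp only at hi ⊢; omega)]
      simp only [totalD, map_sub, map_smul, TensorProduct.map_map_apply]
      simp only [y, d]
      simp only [LinearMap.id_comp]
      abel
  -- In total degree `n + 1`, `x - totalD y` has cycles as right factors, so its right differential
  -- vanishes and the cycle equation leaves only the left one. By flatness of `Z'` the left factors
  -- are then cycles too.
  have h₃ : ∀ i : ℕ × ℕ, ∃ z : Z i.1 ⊗[R] Z' i.2, i.1 + i.2 = n + 1 →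
      (x - totalD X X' y) i = TensorProduct.map (X.iZ i.1) (X'.iZ i.2) z := by
    intro i
    by_cases hi : i.1 + i.2 = n + 1
    · obtain ⟨t, ht⟩ := h₂ i hi
      obtain ⟨a, b⟩ := i
      obtain ⟨z, rfl⟩ : ∃ z : Z a ⊗[R] Z' b, (X.iZ a).rTensor (Z' b) z = t := by
        rcases a with _ | a
        · exact LinearMap.rTensor_surjective (Z' b) X.iZ_zero_surjective t
        · refine (Module.Flat.rTensor_exact (M := Z' b) (X.exact_iZ_δ a) t).1 ?_
          refine tensorMap_injective (f := X.iZ a ∘ₗ X.iB a) (g := X'.iZ b)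
            ((X.iZ_injective a).comp (X.iB_injective a)) (X'.iZ_injective b) ?_
          rw [map_zero]
          have hab : a + b = n := by simp only at hi; omega
          have hc : totalD X X' (x - totalD X X' y) (a, b) = 0 := by
            rw [totalD_sub, totalD_totalD, hx (a, b) hab, sub_zero]
          obtain ⟨t', ht'⟩ := h₂ (a, b + 1) (by simp only; omega)
          simp only [totalD] at hc
          rw [← ht, ← ht', TensorProduct.map_map_apply, TensorProduct.map_map_apply, d_iZ,
            TensorProduct.map_zero_right, LinearMap.zero_apply, smul_zero, add_zero] at hc
          refine (TensorProduct.map_map_apply _ _ _ _ t).trans ?_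
          exact hc
      refine ⟨z, fun _ => ?_⟩
      rw [← ht, LinearMap.rTensor, TensorProduct.map_map_apply]
      rfl
    · exact ⟨0, fun h => absurd h hi⟩
  choose z hz using h₃
  refine ⟨y, z, fun i hi => ?_⟩
  rw [← hz i hi, Pi.sub_apply, add_sub_cancel]

end HomologyDatum

/-! ### The complex of `∂`-invariant paths as an instance of the algebra. -/

namespace Subquotient

variable {R M P : Type u} [CommRing R] [AddCommGroup M] [Module R M] [AddCommGroup P] [Module R P]

/-- The linear map out of `Z / B` induced by a linear map out of `Z` vanishing on `B`. -/
def desc {Z B : Submodule R M} (f : Z →ₗ[R] P) (h : ∀ z : Z, (z : M) ∈ B → f z = 0) :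
    Subquotient Z B →ₗ[R] P :=
  Submodule.liftQ (B.submoduleOf Z) f fun z hz => h z hz

end Subquotient

theorem Submodule.projective_of_finite {R M : Type u} [CommRing R] [IsDomain R]
    [IsPrincipalIdealRing R] [AddCommGroup M] [Module R M] [Module.IsTorsionFree R M]
    (A : Submodule R M) (hA : Module.Finite R A) : Module.Projective R A :=
  have : Module.Free R A := Module.free_of_finite_type_torsion_free'
  inferInstance

namespace WeightedDigraph

open PathModule

section Datum

variable {R : Type u} [CommRing R] (G G' : WeightedDigraph R)

/-- The `∂`-invariant paths modulo boundaries. -/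
abbrev OmegaModBoundaries (k : ℕ) : Type u := Subquotient (G.Omega k) (G.boundaries k)

theorem d_mem_boundaries {k : ℕ} : ∀ x ∈ G.Omega (k + 1), G.d x ∈ G.boundaries k :=
  fun x hx => ⟨x, hx, rfl⟩

/-- The boundary operator as a map onto the boundaries. -/
def toBoundaries (k : ℕ) : G.Omega (k + 1) →ₗ[R] G.boundaries k :=
  G.d.restrict G.d_mem_boundaries

theorem d_boundaries {k : ℕ} {x : PathModule R G.V} (hx : x ∈ G.boundaries k) : G.d x = 0 :=
  (G.boundaries_le_cycles k hx).2

theorem toBoundaries_eq_zero {k : ℕ} (x : G.Omega (k + 1))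
    (hx : (x : PathModule R G.V) ∈ G.boundaries (k + 1)) : G.toBoundaries k x = 0 :=
  Subtype.ext (G.d_boundaries hx)

/-- The map induced by the boundary operator on paths modulo boundaries. -/
def boundaryOfClass (k : ℕ) : G.OmegaModBoundaries (k + 1) →ₗ[R] G.boundaries k :=
  @Subquotient.desc R (PathModule R G.V) (G.boundaries k) _ _ _ _ _ (G.Omega (k + 1))
    (G.boundaries (k + 1)) (G.toBoundaries k) G.toBoundaries_eq_zero

/-- The modules of weighted path homology. -/
def datum : HomologyDatum R (fun k => G.Omega k) (fun k => G.cycles k) (fun k => G.boundaries k)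
    (fun k => G.Homology k) (fun k => G.OmegaModBoundaries k) where
  iZ k := Submodule.inclusion inf_le_left
  iB k := Submodule.inclusion (G.boundaries_le_cycles k)
  δ := G.toBoundaries
  π k := Subquotient.mk (G.cycles k) (G.boundaries k)
  κ k := Subquotient.mk (G.Omega k) (G.boundaries k)
  j k := Subquotient.map LinearMap.id (fun _ hx => hx.1) (fun _ hx => hx)
  dQ k := G.boundaryOfClass k
  iZ_injective k := Submodule.inclusion_injective _
  iB_injective k := Submodule.inclusion_injective _
  j_injective k := by
    refine (injective_iff_map_eq_zero _).2 fun x hx => ?_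
    obtain ⟨z, rfl⟩ := Subquotient.mk_surjective _ _ x
    rw [Subquotient.map_mk, Subquotient.mk_eq_zero] at hx
    exact (Subquotient.mk_eq_zero _ _ _).2 hx
  δ_surjective k := by
    rintro ⟨_, x, hx, rfl⟩
    exact ⟨⟨x, hx⟩, rfl⟩
  π_surjective k := Subquotient.mk_surjective _ _
  κ_surjective k := Subquotient.mk_surjective _ _
  iZ_zero_surjective x := ⟨⟨x.1, x.2, G.d_ofLength_zero x.2.1.1⟩, rfl⟩
  exact_iB_π k z := by
    refine (Subquotient.mk_eq_zero _ _ z).trans ⟨fun h => ⟨⟨z.1, h⟩, rfl⟩, ?_⟩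
    rintro ⟨b, rfl⟩
    exact b.2
  exact_iZ_δ k x := by
    refine ⟨fun h => ⟨⟨x.1, x.2, congrArg Subtype.val h⟩, rfl⟩, ?_⟩
    rintro ⟨z, rfl⟩
    exact Subtype.ext z.2.2
  exact_κ k x := by
    refine (Subquotient.mk_eq_zero _ _ x).trans ⟨fun h => ⟨⟨x.1, h⟩, rfl⟩, ?_⟩
    rintro ⟨b, rfl⟩
    exact b.2
  exact_j_dQ k q := by
    obtain ⟨x, rfl⟩ := Subquotient.mk_surjective _ _ q
    refine ⟨fun h => ⟨Subquotient.mk _ _ ⟨x.1, x.2, congrArg Subtype.val h⟩, rfl⟩, ?_⟩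
    rintro ⟨h, hx⟩
    obtain ⟨z, rfl⟩ := Subquotient.mk_surjective _ _ h
    rw [← hx]
    exact Subtype.ext z.2.2
  j_π k := rfl

variable [IsDomain R] [IsPrincipalIdealRing R]

/-- A finite vertex set has finitely many words of a given length. Finiteness turns torsion-free
into free, hence projective. -/
theorem finite_of_le_ofLength {k : ℕ} {A : Submodule R (PathModule R G.V)}
    (hA : A ≤ G.ofLength k) : Module.Finite R A := by
  have := G.finite
  have hf : Finite {l : List G.V | l.length = k} := List.finite_length_eq G.V k
  have : IsNoetherian R ({l : List G.V | l.length = k} →₀ R) := inferInstance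
  have : IsNoetherian R (G.ofLength k) :=
    isNoetherian_of_linearEquiv (Finsupp.supportedEquivFinsupp {l : List G.V | l.length = k}).symm
  have := isNoetherian_of_le hA
  infer_instance

theorem projective_of_le_ofLength {k : ℕ} {A : Submodule R (PathModule R G.V)}
    (hA : A ≤ G.ofLength k) : Module.Projective R A :=
  A.projective_of_finite (G.finite_of_le_ofLength hA)

instance (k : ℕ) : Module.Projective R (G.Omega k) :=
  G.projective_of_le_ofLength fun _ hx => hx.1.1

instance (k : ℕ) : Module.Projective R (G.cycles k) :=
  G.projective_of_le_ofLength fun _ hx => hx.1.1.1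

instance (k : ℕ) : Module.Projective R (G.boundaries k) :=
  G.projective_of_le_ofLength fun _ hx => (G.boundaries_le_cycles k hx).1.1.1

end Datum

/-! ### Concatenation as a chain map. -/

section Total

variable {R : Type u} [CommRing R] (G G' : WeightedDigraph R)

theorem omegaConcat_zero_d {b : ℕ} (x : G.Omega 0 ⊗[R] G'.Omega b) :
    concatTensor R G.V G'.V (TensorProduct.map (G.d ∘ₗ (G.Omega 0).subtype)
      (G'.Omega b).subtype x) = 0 := by
  have : G.d ∘ₗ (G.Omega 0).subtype = 0 := by
    ext1 y
    exact G.d_ofLength_zero y.2.1.1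
  rw [this, TensorProduct.map_zero_left, LinearMap.zero_apply, map_zero]

theorem omegaConcat_d_zero {a : ℕ} (x : G.Omega a ⊗[R] G'.Omega 0) :
    concatTensor R G.V G'.V (TensorProduct.map (G.Omega a).subtype
      (G'.d ∘ₗ (G'.Omega 0).subtype) x) = 0 := by
  have : G'.d ∘ₗ (G'.Omega 0).subtype = 0 := by
    ext1 y
    exact G'.d_ofLength_zero y.2.1.1
  rw [this, TensorProduct.map_zero_right, LinearMap.zero_apply, map_zero]

theorem d_omegaConcat (a b : ℕ) (x : G.Omega a ⊗[R] G'.Omega b) :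
    (G.join G').d (omegaConcat G G' a b x) =
      concatTensor R G.V G'.V (TensorProduct.map (G.d ∘ₗ (G.Omega a).subtype)
        (G'.Omega b).subtype x) +
      (-1 : R) ^ a • concatTensor R G.V G'.V (TensorProduct.map (G.Omega a).subtype
        (G'.d ∘ₗ (G'.Omega b).subtype) x) := by
  induction x using TensorProduct.induction_on with
  | zero => simp
  | tmul x y => exact d_concat x.2 y.2
  | add x y hx hy =>
    simp only [map_add, smul_add]
    rw [hx, hy]
    abel

theorem omegaConcat_map_d (a b : ℕ) (x : G.Omega (a + 1) ⊗[R] G'.Omega b) :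
    omegaConcat G G' a b (TensorProduct.map (G.datum.d a) LinearMap.id x) =
      concatTensor R G.V G'.V (TensorProduct.map (G.d ∘ₗ (G.Omega (a + 1)).subtype)
        (G'.Omega b).subtype x) := by
  induction x using TensorProduct.induction_on with
  | zero => simp
  | tmul x y => rfl
  | add x y hx hy => rw [map_add, map_add, hx, hy, map_add, map_add]

theorem omegaConcat_map_d' (a b : ℕ) (x : G.Omega a ⊗[R] G'.Omega (b + 1)) :
    omegaConcat G G' a b (TensorProduct.map LinearMap.id (G'.datum.d b) x) =
      concatTensor R G.V G'.V (TensorProduct.map (G.Omega a).subtype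
        (G'.d ∘ₗ (G'.Omega (b + 1)).subtype) x) := by
  induction x using TensorProduct.induction_on with
  | zero => simp
  | tmul x y => rfl
  | add x y hx hy => rw [map_add, map_add, hx, hy, map_add, map_add]

theorem d_totalConcat (n : ℕ) (x : ∀ i : ℕ × ℕ, G.Omega i.1 ⊗[R] G'.Omega i.2) :
    (G.join G').d (totalConcat G G' (n + 1) x) =
      totalConcat G G' n (HomologyDatum.totalD G.datum G'.datum x) := by
  have h : ∀ i ∈ Finset.HasAntidiagonal.antidiagonal (n + 1), _ :=
    fun i _ => d_omegaConcat G G' i.1 i.2 (x i)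
  -- Each Leibniz term is reindexed from the antidiagonal of `n + 1` to that of `n`; the end terms
  -- left over differentiate the empty path and vanish.
  rw [totalConcat_apply, totalConcat_apply, map_sum, Finset.sum_congr rfl h,
    Finset.sum_add_distrib, Finset.Nat.sum_antidiagonal_succ, Finset.Nat.sum_antidiagonal_succ',
    omegaConcat_zero_d, omegaConcat_d_zero, smul_zero, zero_add, zero_add,
    ← Finset.sum_add_distrib]
  refine Finset.sum_congr rfl fun i _ => ?_
  rw [HomologyDatum.totalD, map_add, map_smul, omegaConcat_map_d, omegaConcat_map_d']

end Total

end WeightedDigraph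

theorem LinearMap.apply_eq_of_apply_eq {R M N P : Type*} [CommRing R] [AddCommMonoid M]
    [Module R M] [AddCommGroup N] [Module R N] [AddCommGroup P] [Module R P] {f : M →ₗ[R] N}
    {g : M →ₗ[R] P} (h : ∀ x, f x = 0 → g x = 0) {x y : M} (hxy : f x = f y) : g x = g y := by
  have := h (x + (-1 : R) • y) (by rw [map_add, map_smul, hxy]; simp)
  rw [map_add, map_smul, neg_one_smul] at this
  exact add_neg_eq_zero.1 this

/-! ### The Künneth sequence of a join. -/

namespace WeightedDigraph

open PathModule

section Kunneth

variable {R : Type u} [CommRing R] (G G' : WeightedDigraph R)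

theorem totalConcat_congr {n : ℕ} {x y : ∀ i : ℕ × ℕ, G.Omega i.1 ⊗[R] G'.Omega i.2}
    (h : ∀ i : ℕ × ℕ, i.1 + i.2 = n → x i = y i) :
    totalConcat G G' n x = totalConcat G G' n y := by
  rw [totalConcat_apply, totalConcat_apply]
  exact Finset.sum_congr rfl fun i hi => by rw [h i (Finset.HasAntidiagonal.mem_antidiagonal.1 hi)]

/-- The tensor product of the cycles in `Omega ⊗ Omega`. -/
def cyclesConcat (i : ℕ × ℕ) (z : G.cycles i.1 ⊗[R] G'.cycles i.2) :
    G.Omega i.1 ⊗[R] G'.Omega i.2 :=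
  TensorProduct.map (G.datum.iZ i.1) (G'.datum.iZ i.2) z

/-- The class in the tensor product of homology modules. -/
def cyclesClass (i : ℕ × ℕ) (z : G.cycles i.1 ⊗[R] G'.cycles i.2) :
    G.Homology i.1 ⊗[R] G'.Homology i.2 :=
  TensorProduct.map (G.datum.π i.1) (G'.datum.π i.2) z

theorem omegaConcat_cyclesConcat_mem {n : ℕ} (i : ℕ × ℕ) (hi : i.1 + i.2 = n)
    (z : G.cycles i.1 ⊗[R] G'.cycles i.2) :
    omegaConcat G G' i.1 i.2 (cyclesConcat G G' i z) ∈ (G.join G').cycles n := by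
  unfold cyclesConcat
  induction z using TensorProduct.induction_on with
  | zero => simp
  | tmul x y => exact concat_cycles hi x.2 y.2
  | add x y hx hy => rw [map_add, map_add]; exact add_mem hx hy

theorem homologyCross_cyclesClass {n : ℕ} (i : ℕ × ℕ) (hi : i.1 + i.2 = n)
    (z : G.cycles i.1 ⊗[R] G'.cycles i.2) :
    homologyCross G G' hi (cyclesClass G G' i z) =
      Subquotient.mk _ _ ⟨_, omegaConcat_cyclesConcat_mem G G' i hi z⟩ := by
  induction z using TensorProduct.induction_on with
  | zero =>
    rw [cyclesClass, map_zero, map_zero]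
    refine ((Subquotient.mk_eq_zero _ _ _).2 ?_).symm
    simp [cyclesConcat]
  | tmul x y => rfl
  | add x y hx hy =>
    rw [cyclesClass, map_add, map_add]
    refine (congrArg₂ (· + ·) hx hy).trans ?_
    rw [← map_add]
    congr 1
    ext1
    simp [cyclesConcat]

/-- The element of the tensor term of the Künneth sequence given by a family. -/
def tensorFamily (r : ℕ) (z : ∀ i : ℕ × ℕ, G.cycles i.1 ⊗[R] G'.cycles i.2) :
    KunnethTensor G G' r :=
  ∑ i : Finset.HasAntidiagonal.antidiagonal (r + 1),
    DirectSum.lof R _ (fun i : Finset.HasAntidiagonal.antidiagonal (r + 1) =>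
      G.Homology i.1.1 ⊗[R] G'.Homology i.1.2) i (cyclesClass G G' i.1 (z i.1))

theorem exists_tensorFamily (r : ℕ) (h : KunnethTensor G G' r) :
    ∃ z, tensorFamily G G' r z = h := by
  have hs : ∀ i : ℕ × ℕ, Function.Surjective (cyclesClass G G' i) := fun i =>
    TensorProduct.map_surjective (G.datum.π_surjective i.1) (G'.datum.π_surjective i.2)
  choose z hz using fun i : Finset.HasAntidiagonal.antidiagonal (r + 1) => hs i.1 (h i)
  refine ⟨fun i => if hi : i ∈ Finset.HasAntidiagonal.antidiagonal (r + 1) then z ⟨i, hi⟩ else 0,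
    ?_⟩
  rw [tensorFamily]
  conv_rhs => rw [← DirectSum.sum_univ_of h]
  refine Finset.sum_congr rfl fun i _ => ?_
  rw [dif_pos i.2, ← hz i]
  rfl

theorem totalConcat_cyclesConcat_mem {n : ℕ}
    (z : ∀ i : ℕ × ℕ, G.cycles i.1 ⊗[R] G'.cycles i.2) :
    totalConcat G G' n (fun i => cyclesConcat G G' i (z i)) ∈ (G.join G').cycles n := by
  rw [totalConcat_apply]
  exact Submodule.sum_mem _ fun i hi =>
    omegaConcat_cyclesConcat_mem G G' i (Finset.HasAntidiagonal.mem_antidiagonal.1 hi) _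

theorem kunnethCross_lof (r : ℕ) (i : Finset.HasAntidiagonal.antidiagonal (r + 1))
    (t : G.Homology i.1.1 ⊗[R] G'.Homology i.1.2) :
    kunnethCross G G' r (DirectSum.lof R _ (fun i : Finset.HasAntidiagonal.antidiagonal (r + 1) =>
      G.Homology i.1.1 ⊗[R] G'.Homology i.1.2) i t) =
      homologyCross G G' (Finset.HasAntidiagonal.mem_antidiagonal.1 i.2) t := by
  rw [kunnethCross, DirectSum.toModule_lof]

theorem kunnethCross_tensorFamily (r : ℕ)
    (z : ∀ i : ℕ × ℕ, G.cycles i.1 ⊗[R] G'.cycles i.2) :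
    kunnethCross G G' r (tensorFamily G G' r z) =
      Subquotient.mk _ _ ⟨_, totalConcat_cyclesConcat_mem G G' (n := r + 1) z⟩ := by
  rw [tensorFamily, map_sum]
  have h : ∀ i ∈ (Finset.univ : Finset (Finset.HasAntidiagonal.antidiagonal (r + 1))),
      kunnethCross G G' r (DirectSum.lof R _
        (fun i : Finset.HasAntidiagonal.antidiagonal (r + 1) =>
          G.Homology i.1.1 ⊗[R] G'.Homology i.1.2) i (cyclesClass G G' i.1 (z i.1))) =
      Subquotient.mk _ _ ⟨_, omegaConcat_cyclesConcat_mem G G' i.1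
        (Finset.HasAntidiagonal.mem_antidiagonal.1 i.2) (z i.1)⟩ := by
    intro i _
    rw [kunnethCross_lof, homologyCross_cyclesClass]
  rw [Finset.sum_congr rfl h, ← map_sum]
  congr 1
  ext1
  rw [AddSubmonoidClass.coe_finsetSum]
  refine Eq.trans ?_ (totalConcat_apply G G' (r + 1) _).symm
  exact Finset.sum_coe_sort (Finset.HasAntidiagonal.antidiagonal (r + 1))
    fun i => omegaConcat G G' i.1 i.2 (cyclesConcat G G' i (z i))

variable [IsDomain R] [IsPrincipalIdealRing R]

/-- A linear map out of the tensor product complex vanishing on boundaries factors through the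
homology of the join. -/
theorem exists_homology_lift {n : ℕ} {P : Type u} [AddCommGroup P] [Module R P]
    (L : (∀ i : ℕ × ℕ, G.Omega i.1 ⊗[R] G'.Omega i.2) →ₗ[R] P)
    (h₀ : ∀ x, (∀ i : ℕ × ℕ, i.1 + i.2 = n → x i = 0) → L x = 0)
    (h₁ : ∀ y, L (HomologyDatum.totalD G.datum G'.datum y) = 0) :
    ∃ F : (G.join G').Homology n →ₗ[R] P,
      ∀ x (hx : totalConcat G G' n x ∈ (G.join G').cycles n),
        F (Subquotient.mk _ _ ⟨_, hx⟩) = L x := by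
  -- Concatenation determines the entries of total degree `n`, and `h₀` makes `L` ignore the others.
  -- Hence `L` of an arbitrary preimage is linear in the cycle.
  have hL : ∀ x y, totalConcat G G' n x = totalConcat G G' n y → L x = L y := by
    intro x y hxy
    exact LinearMap.apply_eq_of_apply_eq
      (fun w hw => h₀ w fun i hi => totalConcat_eq_zero G G' (n := n) hw hi) hxy
  choose x hx using fun z : (G.join G').cycles n => exists_totalConcat G G' z.2.1
  let f : (G.join G').cycles n →ₗ[R] P :=
    { toFun := fun z => L (x z)
      map_add' := fun z w => by
        rw [← map_add]
        refine hL _ _ ?_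
        rw [map_add, hx, hx, hx]
        rfl
      map_smul' := fun c z => by
        rw [RingHom.id_apply, ← map_smul]
        refine hL _ _ ?_
        rw [map_smul, hx, hx]
        rfl }
  refine ⟨Subquotient.desc f ?_, fun y hy => hL _ _ (hx ⟨_, hy⟩)⟩
  rintro ⟨_, hz⟩ ⟨w, hw, rfl⟩
  obtain ⟨y, rfl⟩ := exists_totalConcat G G' hw
  refine Eq.trans (hL _ _ ?_) (h₁ y)
  rw [hx, ← d_totalConcat]

theorem totalD_eq_zero {n : ℕ} {x : ∀ i : ℕ × ℕ, G.Omega i.1 ⊗[R] G'.Omega i.2}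
    (hx : totalConcat G G' (n + 1) x ∈ (G.join G').cycles (n + 1)) {i : ℕ × ℕ}
    (hi : i.1 + i.2 = n) : HomologyDatum.totalD G.datum G'.datum x i = 0 := by
  refine totalConcat_eq_zero G G' ?_ hi
  rw [← d_totalConcat]
  exact hx.2

theorem exists_representative {n : ℕ} (c : (G.join G').Homology n) :
    ∃ (x : ∀ i : ℕ × ℕ, G.Omega i.1 ⊗[R] G'.Omega i.2)
      (hx : totalConcat G G' n x ∈ (G.join G').cycles n), Subquotient.mk _ _ ⟨_, hx⟩ = c := by
  obtain ⟨⟨z, hz⟩, rfl⟩ := Subquotient.mk_surjective _ _ c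
  obtain ⟨x, rfl⟩ := exists_totalConcat G G' hz.1
  exact ⟨x, hz, rfl⟩

/-- `HomologyDatum.torPart` as a linear map. -/
def torPartLinear (i : ℕ × ℕ) :
    (∀ i : ℕ × ℕ, G.Omega i.1 ⊗[R] G'.Omega i.2) →ₗ[R]
      G.OmegaModBoundaries i.1 ⊗[R] G'.boundaries i.2 where
  toFun x := HomologyDatum.torPart G.datum G'.datum i x
  map_add' x y := by simp [HomologyDatum.torPart]
  map_smul' c x := by simp [HomologyDatum.torPart]

/-- The embedding of `Tor₁(H_a(G), H_b(G'))` into `Ω_a(G) / B_a(G) ⊗ B_b(G')`. -/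
def torInto (i : ℕ × ℕ) : TorOne R (G.Homology i.1) (G'.Homology i.2) →ₗ[R]
    G.OmegaModBoundaries i.1 ⊗[R] G'.boundaries i.2 :=
  HomologyDatum.torInto G.datum G'.datum i

theorem torInto_injective (i : ℕ × ℕ) : Function.Injective (torInto G G' i) :=
  HomologyDatum.torInto_injective G.datum G'.datum i

/-- The property characterizing the second map of the Künneth sequence. -/
def IsKunnethBoundary (r : ℕ) (β : (G.join G').Homology (r + 1) →ₗ[R] KunnethTor G G' r) : Prop :=
  ∀ x (hx : totalConcat G G' (r + 1) x ∈ (G.join G').cycles (r + 1))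
    (i : Finset.HasAntidiagonal.antidiagonal r),
    torInto G G' i.1 (β (Subquotient.mk _ _ ⟨_, hx⟩) i) = torPartLinear G G' i.1 x

/-- `torPart` descends to homology with values in the image of the injective `torInto`, which can
then be inverted. -/
theorem exists_isKunnethBoundary (r : ℕ) :
    ∃ β : (G.join G').Homology (r + 1) →ₗ[R] KunnethTor G G' r, IsKunnethBoundary G G' r β := by
  have h : ∀ i : Finset.HasAntidiagonal.antidiagonal r,
      ∃ β : (G.join G').Homology (r + 1) →ₗ[R] TorOne R (G.Homology i.1.1) (G'.Homology i.1.2),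
        ∀ x (hx : totalConcat G G' (r + 1) x ∈ (G.join G').cycles (r + 1)),
          torInto G G' i.1 (β (Subquotient.mk _ _ ⟨_, hx⟩)) = torPartLinear G G' i.1 x := by
    rintro ⟨i, hi⟩
    rw [Finset.HasAntidiagonal.mem_antidiagonal] at hi
    obtain ⟨F, hF⟩ := exists_homology_lift G G' (n := r + 1) (torPartLinear G G' i)
      (fun x hx => by
        change TensorProduct.map _ _ (x (i.1, i.2 + 1)) = 0
        rw [hx (i.1, i.2 + 1) (by simp only; omega), map_zero])
      (fun y => HomologyDatum.torPart_totalD G.datum G'.datum y i)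
    have hr : ∀ c, F c ∈ LinearMap.range (torInto G G' i) := by
      intro c
      obtain ⟨x, hx, rfl⟩ := exists_representative G G' c
      rw [hF]
      exact HomologyDatum.exists_torInto_eq_torPart G.datum G'.datum (totalD_eq_zero G G' hx hi)
    let e := LinearEquiv.ofInjective (torInto G G' i) (torInto_injective G G' i)
    refine ⟨e.symm.toLinearMap ∘ₗ F.codRestrict _ hr, fun x hx => ?_⟩
    rw [← hF x hx]
    exact congrArg Subtype.val (e.apply_symm_apply ⟨_, hr (Subquotient.mk _ _ ⟨_, hx⟩)⟩)
  choose β hβ using h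
  exact ⟨(DirectSum.linearEquivFunOnFintype R _ _).symm.toLinearMap ∘ₗ LinearMap.pi β,
    fun x hx i => hβ i x hx⟩

/-- The family of images under `ρ ⊗ ρ'`. -/
def homologyFamily (r : ℕ) (ρ : ∀ k, G.Omega k →ₗ[R] G.Homology k)
    (ρ' : ∀ k, G'.Omega k →ₗ[R] G'.Homology k) :
    (∀ i : ℕ × ℕ, G.Omega i.1 ⊗[R] G'.Omega i.2) →ₗ[R] KunnethTensor G G' r :=
  ∑ i : Finset.HasAntidiagonal.antidiagonal (r + 1),
    DirectSum.lof R _ (fun i : Finset.HasAntidiagonal.antidiagonal (r + 1) =>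
      G.Homology i.1.1 ⊗[R] G'.Homology i.1.2) i ∘ₗ
      TensorProduct.map (ρ i.1.1) (ρ' i.1.2) ∘ₗ LinearMap.proj i.1

theorem homologyFamily_apply (r : ℕ) (ρ : ∀ k, G.Omega k →ₗ[R] G.Homology k)
    (ρ' : ∀ k, G'.Omega k →ₗ[R] G'.Homology k)
    (x : ∀ i : ℕ × ℕ, G.Omega i.1 ⊗[R] G'.Omega i.2) :
    homologyFamily G G' r ρ ρ' x = ∑ i : Finset.HasAntidiagonal.antidiagonal (r + 1),
      DirectSum.lof R _ (fun i : Finset.HasAntidiagonal.antidiagonal (r + 1) =>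
        G.Homology i.1.1 ⊗[R] G'.Homology i.1.2) i
        (TensorProduct.map (ρ i.1.1) (ρ' i.1.2) (x i.1)) := by
  simp [homologyFamily, LinearMap.sum_apply]

theorem homologyFamily_eq_zero {r : ℕ} {ρ : ∀ k, G.Omega k →ₗ[R] G.Homology k}
    {ρ' : ∀ k, G'.Omega k →ₗ[R] G'.Homology k}
    {x : ∀ i : ℕ × ℕ, G.Omega i.1 ⊗[R] G'.Omega i.2}
    (hx : ∀ i : ℕ × ℕ, i.1 + i.2 = r + 1 → TensorProduct.map (ρ i.1) (ρ' i.2) (x i) = 0) :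
    homologyFamily G G' r ρ ρ' x = 0 := by
  rw [homologyFamily_apply]
  refine Finset.sum_eq_zero fun i _ => ?_
  rw [hx i.1 (Finset.HasAntidiagonal.mem_antidiagonal.1 i.2), map_zero]

theorem homologyFamily_cyclesConcat {r : ℕ} {ρ : ∀ k, G.Omega k →ₗ[R] G.Homology k}
    {ρ' : ∀ k, G'.Omega k →ₗ[R] G'.Homology k}
    (hρ : ∀ k, ρ k ∘ₗ G.datum.iZ k = G.datum.π k)
    (hρ' : ∀ k, ρ' k ∘ₗ G'.datum.iZ k = G'.datum.π k)
    (z : ∀ i : ℕ × ℕ, G.cycles i.1 ⊗[R] G'.cycles i.2) :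
    homologyFamily G G' r ρ ρ' (fun i => cyclesConcat G G' i (z i)) = tensorFamily G G' r z := by
  rw [homologyFamily_apply, tensorFamily]
  have h : ∀ i : ℕ × ℕ, TensorProduct.map (ρ i.1) (ρ' i.2) (cyclesConcat G G' i (z i)) =
      cyclesClass G G' i (z i) := fun i =>
    HomologyDatum.map_cyclesFamily G.datum G'.datum (hρ i.1) (hρ' i.2) z
  exact Finset.sum_congr rfl fun i _ => congrArg _ (h i.1)

/-- The retraction of the first map of the Künneth sequence. -/
theorem exists_kunnethCross_leftInverse (r : ℕ) :
    ∃ l : (G.join G').Homology (r + 1) →ₗ[R] KunnethTensor G G' r,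
      ∀ h, l (kunnethCross G G' r h) = h := by
  -- The left inverse is induced by `ρ ⊗ ρ'`, which is the class map on products of cycles.
  choose ρ hρ using G.datum.exists_toHomology
  choose ρ' hρ' using G'.datum.exists_toHomology
  obtain ⟨F, hF⟩ := exists_homology_lift G G' (n := r + 1) (homologyFamily G G' r ρ ρ')
    (fun x hx => homologyFamily_eq_zero G G' fun i hi => by rw [hx i hi, map_zero])
    (fun y => homologyFamily_eq_zero G G' fun i _ =>
      HomologyDatum.map_totalD_eq_zero G.datum G'.datum (hρ i.1) (hρ' i.2) y)
  refine ⟨F, fun h => ?_⟩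
  obtain ⟨z, hz⟩ := exists_tensorFamily G G' r h
  have h₁ := (hF _ (totalConcat_cyclesConcat_mem G G' z)).trans
    (homologyFamily_cyclesConcat G G' hρ hρ' z)
  rw [← hz, kunnethCross_tensorFamily]
  exact h₁

namespace IsKunnethBoundary

variable {G G'} {r : ℕ} {β : (G.join G').Homology (r + 1) →ₗ[R] KunnethTor G G' r}

theorem apply_kunnethCross (hβ : IsKunnethBoundary G G' r β) (h : KunnethTensor G G' r) :
    β (kunnethCross G G' r h) = 0 := by
  obtain ⟨z, hz⟩ := exists_tensorFamily G G' r h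
  rw [← hz, kunnethCross_tensorFamily]
  refine DFinsupp.ext fun i => torInto_injective G G' i.1 ?_
  refine (hβ _ _ i).trans (Eq.trans ?_ (map_zero _).symm)
  exact HomologyDatum.torPart_cyclesFamily G.datum G'.datum i.1 z

/-- If `β` kills the class then `torPart` of a representing family vanishes on the antidiagonal of
`r`, so the family is a sum of products of cycles plus some `totalD y`, and the latter concatenates
to a boundary. -/
theorem exists_kunnethCross (hβ : IsKunnethBoundary G G' r β) {c : (G.join G').Homology (r + 1)}
    (hc : β c = 0) : ∃ h, kunnethCross G G' r h = c := by
  obtain ⟨x, hx, rfl⟩ := exists_representative G G' c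
  obtain ⟨y, z, hyz⟩ := HomologyDatum.exists_cycle_tensor G.datum G'.datum (n := r) (x := x)
    (fun i hi => totalD_eq_zero G G' hx hi) (fun i hi => by
      have := hβ x hx ⟨i, Finset.HasAntidiagonal.mem_antidiagonal.2 hi⟩
      rw [hc] at this
      exact this.symm.trans (map_zero _))
  refine ⟨tensorFamily G G' r z, ?_⟩
  rw [kunnethCross_tensorFamily, ← sub_eq_zero, ← map_sub, Subquotient.mk_eq_zero]
  refine ⟨-totalConcat G G' (r + 2) y, neg_mem (totalConcat_mem G G' _ y), ?_⟩
  rw [map_neg, d_totalConcat]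
  have h₁ := totalConcat_congr G G' hyz
  have h₂ := map_add (totalConcat G G' (r + 1)) (HomologyDatum.totalD G.datum G'.datum y)
    (fun i => cyclesConcat G G' i (z i))
  have h₃ := h₁.trans h₂
  change -_ = _ - totalConcat G G' (r + 1) x
  rw [h₃]
  abel

theorem surjective (hβ : IsKunnethBoundary G G' r β) : Function.Surjective β := by
  intro τ
  -- The family `τ` is extended by 0 to all bidegrees.
  obtain ⟨x, hx, hτ⟩ := HomologyDatum.exists_cycle_torPart G.datum G'.datum fun i =>
    if hi : i ∈ Finset.HasAntidiagonal.antidiagonal r then τ ⟨i, hi⟩ else 0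
  have hc : totalConcat G G' (r + 1) x ∈ (G.join G').cycles (r + 1) := by
    refine ⟨totalConcat_mem G G' (r + 1) x, ?_⟩
    refine LinearMap.mem_ker.2 ?_
    rw [d_totalConcat, show HomologyDatum.totalD G.datum G'.datum x = 0 from funext hx, map_zero]
  refine ⟨Subquotient.mk _ _ ⟨_, hc⟩, ?_⟩
  refine DFinsupp.ext fun i => torInto_injective G G' i.1 ?_
  refine (hβ x hc i).trans ((hτ i.1).trans ?_)
  rw [dif_pos i.2]
  rfl

theorem exact (hβ : IsKunnethBoundary G G' r β) : Function.Exact (kunnethCross G G' r) β :=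
  fun _ => ⟨fun hc => hβ.exists_kunnethCross hc, fun hc => by
    obtain ⟨h, hh⟩ := hc
    rw [← hh, hβ.apply_kunnethCross]⟩

theorem isSplitShortExact (hβ : IsKunnethBoundary G G' r β) :
    IsSplitShortExact (kunnethCross G G' r) β := by
  obtain ⟨l, hl⟩ := exists_kunnethCross_leftInverse G G' r
  have hinj : Function.Injective (kunnethCross G G' r) := Function.LeftInverse.injective hl
  have hs : ∃ l, l ∘ₗ kunnethCross G G' r = LinearMap.id := ⟨l, LinearMap.ext hl⟩
  exact ⟨hinj, hβ.exact, hβ.surjective, ((hβ.exact.split_tfae hinj hβ.surjective).out 0 1).2 hs⟩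

end IsKunnethBoundary

end Kunneth

end WeightedDigraph

/-! ### Naturality with respect to morphisms of weighted digraphs. -/

theorem PathModule.push_concat {R V V' W W' : Type u} [CommRing R] (f : V → W) (f' : V' → W')
    (x : PathModule R V) (y : PathModule R V') :
    push R (Sum.map f f') (concat R V V' x y) = concat R W W' (push R f x) (push R f' y) := by
  have h : (concat R V V').compr₂ (Finsupp.lmapDomain R R (List.map (Sum.map f f'))) =
      (concat R W W').compl₁₂ (Finsupp.lmapDomain R R (List.map f))
        (Finsupp.lmapDomain R R (List.map f')) := by
    ext1 l
    ext1
    ext1 l'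
    ext1
    simp only [LinearMap.comp_apply, Finsupp.lsingle_apply, LinearMap.compr₂_apply,
      LinearMap.compl₁₂_apply, concat_single, Finsupp.lmapDomain_apply, Finsupp.mapDomain_single]
    simp [Function.comp_def]
  have := congrArg (regularize R (W ⊕ W')) (LinearMap.congr_fun₂ h x y)
  simp only [LinearMap.compl₁₂_apply, regularize_concat] at this
  exact this

namespace WeightedDigraph

open PathModule

variable {R : Type u} [CommRing R] {G H G' H' : WeightedDigraph R}

theorem Hom.push_boundaries (f : Hom G H) (k : ℕ) :
    ∀ x ∈ G.boundaries k, push R f.toFun x ∈ H.boundaries k := by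
  rintro _ ⟨y, hy, rfl⟩
  exact ⟨push R f.toFun y, push_Omega f hy, d_push f y⟩

/-- The induced map on `∂`-invariant paths. -/
def Hom.omegaMap (f : Hom G H) (k : ℕ) : G.Omega k →ₗ[R] H.Omega k :=
  (push R f.toFun).restrict fun _ hx => push_Omega f hx

/-- The induced map on cycles. -/
def Hom.cyclesMap (f : Hom G H) (k : ℕ) : G.cycles k →ₗ[R] H.cycles k :=
  (push R f.toFun).restrict (push_cycles f k)

/-- The induced map on boundaries. -/
def Hom.boundariesMap (f : Hom G H) (k : ℕ) : G.boundaries k →ₗ[R] H.boundaries k :=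
  (push R f.toFun).restrict (f.push_boundaries k)

/-- The induced map on paths modulo boundaries. -/
def Hom.omegaModBoundariesMap (f : Hom G H) (k : ℕ) :
    G.OmegaModBoundaries k →ₗ[R] H.OmegaModBoundaries k :=
  Subquotient.map (push R f.toFun) (fun _ hx => push_Omega f hx) (f.push_boundaries k)

theorem Hom.datum_δ_omegaMap (f : Hom G H) (k : ℕ) (x : G.Omega (k + 1)) :
    H.datum.δ k (f.omegaMap (k + 1) x) = f.boundariesMap k (G.datum.δ k x) :=
  Subtype.ext (d_push f x.1)

theorem Hom.datum_j_homologyMap (f : Hom G H) (k : ℕ) (x : G.Homology k) :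
    H.datum.j k (f.homologyMap k x) = f.omegaModBoundariesMap k (G.datum.j k x) := by
  obtain ⟨z, rfl⟩ := Subquotient.mk_surjective _ _ x
  rfl

theorem Hom.homologyMap_comp_π (f : Hom G H) (k : ℕ) :
    H.datum.π k ∘ₗ f.cyclesMap k = f.homologyMap k ∘ₗ G.datum.π k := rfl

theorem Hom.cyclesMap_comp_iB (f : Hom G H) (k : ℕ) :
    H.datum.iB k ∘ₗ f.boundariesMap k = f.cyclesMap k ∘ₗ G.datum.iB k := rfl

/-- The induced map on the tensor product complex. -/
def totalMap (f : Hom G H) (f' : Hom G' H') (x : ∀ i : ℕ × ℕ, G.Omega i.1 ⊗[R] G'.Omega i.2)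
    (i : ℕ × ℕ) : H.Omega i.1 ⊗[R] H'.Omega i.2 :=
  TensorProduct.map (f.omegaMap i.1) (f'.omegaMap i.2) (x i)

theorem push_omegaConcat (f : Hom G H) (f' : Hom G' H') (a b : ℕ)
    (x : G.Omega a ⊗[R] G'.Omega b) :
    push R (f.join f').toFun (omegaConcat G G' a b x) =
      omegaConcat H H' a b (TensorProduct.map (f.omegaMap a) (f'.omegaMap b) x) := by
  induction x using TensorProduct.induction_on with
  | zero => simp
  | tmul x y => exact push_concat f.toFun f'.toFun x.1 y.1
  | add x y hx hy => rw [map_add, map_add, hx, hy, map_add, map_add]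

theorem push_totalConcat (f : Hom G H) (f' : Hom G' H') (n : ℕ)
    (x : ∀ i : ℕ × ℕ, G.Omega i.1 ⊗[R] G'.Omega i.2) :
    push R (f.join f').toFun (totalConcat G G' n x) = totalConcat H H' n (totalMap f f' x) := by
  rw [totalConcat_apply, totalConcat_apply, map_sum]
  exact Finset.sum_congr rfl fun i _ => push_omegaConcat f f' i.1 i.2 (x i)

theorem homologyMap_homologyCross (f : Hom G H) (f' : Hom G' H') {a b k : ℕ} (hk : a + b = k)
    (t : G.Homology a ⊗[R] G'.Homology b) :
    (f.join f').homologyMap k (homologyCross G G' hk t) =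
      homologyCross H H' hk (TensorProduct.map (f.homologyMap a) (f'.homologyMap b) t) := by
  induction t using TensorProduct.induction_on with
  | zero => simp
  | tmul x y =>
    obtain ⟨x, rfl⟩ := Subquotient.mk_surjective _ _ x
    obtain ⟨y, rfl⟩ := Subquotient.mk_surjective _ _ y
    exact congrArg (Subquotient.mk _ _) (Subtype.ext (push_concat f.toFun f'.toFun x.1 y.1))
  | add x y hx hy => rw [map_add, map_add, hx, hy, map_add, map_add]

theorem homologyMap_comp_kunnethCross (f : Hom G H) (f' : Hom G' H') (r : ℕ) :
    (f.join f').homologyMap (r + 1) ∘ₗ kunnethCross G G' r =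
      kunnethCross H H' r ∘ₗ kunnethTensorMap f f' r := by
  refine DirectSum.linearMap_ext R fun i => LinearMap.ext fun t => ?_
  simp only [LinearMap.comp_apply]
  rw [kunnethCross_lof, homologyMap_homologyCross, kunnethTensorMap, DirectSum.lmap_lof,
    kunnethCross_lof]

/-- Both `κ` and `δ` commute with the maps induced by morphisms; no chosen retraction enters
`torPart`. -/
theorem torPart_totalMap (f : Hom G H) (f' : Hom G' H') (i : ℕ × ℕ)
    (x : ∀ i : ℕ × ℕ, G.Omega i.1 ⊗[R] G'.Omega i.2) :
    torPartLinear H H' i (totalMap f f' x) =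
      TensorProduct.map (f.omegaModBoundariesMap i.1) (f'.boundariesMap i.2)
        (torPartLinear G G' i x) := by
  have h : ∀ t : G.Omega i.1 ⊗[R] G'.Omega (i.2 + 1),
      TensorProduct.map (H.datum.κ i.1) (H'.datum.δ i.2)
        (TensorProduct.map (f.omegaMap i.1) (f'.omegaMap (i.2 + 1)) t) =
      TensorProduct.map (f.omegaModBoundariesMap i.1) (f'.boundariesMap i.2)
        (TensorProduct.map (G.datum.κ i.1) (G'.datum.δ i.2) t) := by
    intro t
    induction t using TensorProduct.induction_on with
    | zero => simp
    | tmul x y =>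
      rw [TensorProduct.map_tmul, TensorProduct.map_tmul, TensorProduct.map_tmul,
        TensorProduct.map_tmul, f'.datum_δ_omegaMap]
      rfl
    | add x y hx hy => rw [map_add, map_add, hx, hy, map_add, map_add]
  exact h (x (i.1, i.2 + 1))

variable [IsDomain R] [IsPrincipalIdealRing R]

/-- The maps on boundaries and cycles of `G'` lift the map on homology to the resolutions, so the
embedding of `Tor` is natural, and so is `j`. -/
theorem torInto_torMap (f : Hom G H) (f' : Hom G' H') (i : ℕ × ℕ)
    (τ : TorOne R (G.Homology i.1) (G'.Homology i.2)) :
    torInto H H' i (torMap (f.homologyMap i.1) (f'.homologyMap i.2) τ) =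
      TensorProduct.map (f.omegaModBoundariesMap i.1) (f'.boundariesMap i.2)
        (torInto G G' i τ) := by
  have h₁ := LinearMap.congr_fun (torEmb_torMap (G'.datum.isShortResolution i.2)
    (H'.datum.isShortResolution i.2) (f.homologyMap i.1) (f'.boundariesMap i.2)
    (f'.cyclesMap i.2) (f'.homologyMap i.2) (f'.cyclesMap_comp_iB i.2)
    (f'.homologyMap_comp_π i.2)) τ
  have h₂ : ∀ t : G.Homology i.1 ⊗[R] G'.boundaries i.2,
      TensorProduct.map (H.datum.j i.1) LinearMap.id
        (TensorProduct.map (f.homologyMap i.1) (f'.boundariesMap i.2) t) =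
      TensorProduct.map (f.omegaModBoundariesMap i.1) (f'.boundariesMap i.2)
        (TensorProduct.map (G.datum.j i.1) LinearMap.id t) := by
    intro t
    induction t using TensorProduct.induction_on with
    | zero => simp
    | tmul x y =>
      rw [TensorProduct.map_tmul, TensorProduct.map_tmul, TensorProduct.map_tmul,
        TensorProduct.map_tmul, f.datum_j_homologyMap]
      rfl
    | add x y hx hy => rw [map_add, map_add, hx, hy, map_add, map_add]
  exact (congrArg (TensorProduct.map (H.datum.j i.1) LinearMap.id) h₁).trans (h₂ _)

/-- After the injective `torInto`, both sides become `torPart` of the image of a representing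
family. This works for any `β`, `γ` with the characterizing property, so no coherence between
choices is needed. -/
theorem IsKunnethBoundary.naturality {r : ℕ}
    {β : (G.join G').Homology (r + 1) →ₗ[R] KunnethTor G G' r} (hβ : IsKunnethBoundary G G' r β)
    {γ : (H.join H').Homology (r + 1) →ₗ[R] KunnethTor H H' r} (hγ : IsKunnethBoundary H H' r γ)
    (f : Hom G H) (f' : Hom G' H') :
    kunnethTorMap f f' r ∘ₗ β = γ ∘ₗ (f.join f').homologyMap (r + 1) := by
  refine LinearMap.ext fun c => DFinsupp.ext fun i => torInto_injective H H' i.1 ?_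
  obtain ⟨x, hx, rfl⟩ := exists_representative G G' c
  have hy : totalConcat H H' (r + 1) (totalMap f f' x) ∈ (H.join H').cycles (r + 1) := by
    rw [← push_totalConcat]
    exact push_cycles (f.join f') (r + 1) _ hx
  have h : (f.join f').homologyMap (r + 1) (Subquotient.mk _ _ ⟨_, hx⟩) =
      Subquotient.mk _ _ ⟨_, hy⟩ :=
    congrArg (Subquotient.mk _ _) (Subtype.ext (push_totalConcat f f' (r + 1) x))
  have h₁ := torInto_torMap f f' i.1 (β (Subquotient.mk _ _ ⟨_, hx⟩) i)
  rw [hβ x hx i, ← torPart_totalMap, ← hγ _ hy i, ← h] at h₁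
  exact h₁

end WeightedDigraph

end

-- `N` is the number of rows of the ladder, so `n + 1 < N` says that row `n + 1` exists; `N = ⊤` is
-- the infinite case.
open WeightedDigraph in
theorem theorem5p4 {R : Type u} [CommRing R] [IsDomain R] [IsPrincipalIdealRing R] (r : ℕ) :
    ∃ β : ∀ G G' : WeightedDigraph R,
        (G.join G').Homology (r + 1) →ₗ[R] KunnethTor G G' r,
      (∀ G G' : WeightedDigraph R, IsSplitShortExact (kunnethCross G G' r) (β G G')) ∧
      (∀ (N : ℕ∞) (G G' : ℕ → WeightedDigraph R)
        (f : ∀ n : ℕ, ((n + 1 : ℕ) : ℕ∞) < N → Hom (G n) (G (n + 1)))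
        (f' : ∀ n : ℕ, ((n + 1 : ℕ) : ℕ∞) < N → Hom (G' n) (G' (n + 1)))
        (n : ℕ) (hn : ((n + 1 : ℕ) : ℕ∞) < N),
        ((f n hn).join (f' n hn)).homologyMap (r + 1) ∘ₗ kunnethCross (G n) (G' n) r =
            kunnethCross (G (n + 1)) (G' (n + 1)) r ∘ₗ
              kunnethTensorMap (f n hn) (f' n hn) r ∧
        kunnethTorMap (f n hn) (f' n hn) r ∘ₗ β (G n) (G' n) =
            β (G (n + 1)) (G' (n + 1)) ∘ₗ
              ((f n hn).join (f' n hn)).homologyMap (r + 1)) := by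
  choose β hβ using fun G G' : WeightedDigraph R => exists_isKunnethBoundary G G' r
  exact ⟨β, fun G G' => (hβ G G').isSplitShortExact, fun N G G' f f' n hn =>
    ⟨homologyMap_comp_kunnethCross _ _ r, (hβ _ _).naturality (hβ _ _) _ _⟩⟩
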